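/- A 2-spin model consists of vertex weights $\lambda_0,\lambda_1\ge 0$ on the spin set $\Omega=\{0,1\}$ and a symmetric edge-weight function $H\colon\Omega\times\Omega\to\mathbb{R}_{\ge 0}$. For a finite simple graph $G=(V,E)$ put \[ \hom(G,H)=\sum_{x\colon V\to\Omega}\ \prod_{uv\in E}H(x_u,x_v)\prod_{v\in V}\lambda_{x_v}, \] and let $d_v$ denote the degree of $v$ in $G$. The model is called ferromagnetic if the matrix $(H(i,j))_{i,j\in\Omega}$ is positive semidefinite, and antiferromagnetic if all eigenvalues of this matrix, counted with multiplicity, other than the largest one are nonpositive. Then for every 2-spin model: it is antiferromagnetic if and only if $H(0,0)H(1,1)\le H(0,1)^2$, and ferromagnetic if and only if $H(0,0)H(1,1)\ge H(0,1)^2$. Moreover: (a) If the model is antiferromagnetic, then it is biclique-maximizing: for every finite simple graph $G$ without isolated vertices, \[ \hom(G,H)\le\prod_{uv\in E(G)}\hom(K_{d_u,d_v},H)^{1/(d_ud_v)}. \] (b) If the model is ferromagnetic, then it is clique-maximizing: for every finite simple graph $G$, \[ \hom(G,H)\le\prod_{v\in V(G)}\hom(K_{d_v+1},H)^{1/(d_v+1)}.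 \] -/

import Mathlib

universe u w

/-- A spin model (weighted graph with vertex and edge weights, loops allowed) on a finite set of
spins `Ω`: nonnegative vertex weights, i.e. a finite measure on `Ω`, and a symmetric nonnegative
edge weight function `H`. -/
structure SpinModel (Ω : Type*) where
  /-- the vertex weights (the mass of each point of `Ω`) -/
  weight : Ω → ℝ
  /-- the edge weights `H(x, y)` -/
  H : Matrix Ω Ω ℝ
  weight_nonneg : ∀ x, 0 ≤ weight x
  H_nonneg : ∀ x y, 0 ≤ H x y
  H_symm : ∀ x y, H x y = H y x

namespace SpinModel

variable {Ω : Type w}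

/-- The factor `H(x_u, x_v)` contributed by the unordered pair `e = uv`. -/
def edgeFactor (M : SpinModel Ω) {V : Type*} (x : V → Ω) (e : Sym2 V) : ℝ :=
  Sym2.lift ⟨fun u v => M.H (x u) (x v), fun u v => M.H_symm (x u) (x v)⟩ e

open scoped Classical in
/-- The partition function `hom(G, H) = ∑_{x : V → Ω} ∏_{uv ∈ E(G)} H(x_u, x_v) ∏_v λ(x_v)`; this
is the integral of `∏_{uv ∈ E(G)} H(x_u, x_v)` against the product of the vertex measures. -/
noncomputable def hom [Fintype Ω] (M : SpinModel Ω) {V : Type*} [Fintype V]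
    (G : SimpleGraph V) : ℝ :=
  ∑ x : V → Ω, (∏ e ∈ G.edgeFinset, M.edgeFactor x e) * ∏ v, M.weight (x v)

theorem edgeFactor_map (M : SpinModel Ω) {V W : Type*} (f : V → W) (x : W → Ω) (e : Sym2 V) :
    M.edgeFactor x (e.map f) = M.edgeFactor (x ∘ f) e := by
  induction e with | _ u v => rfl

theorem hom_congr [Fintype Ω] (M : SpinModel Ω) {V W : Type*} [Fintype V] [Fintype W]
    {G : SimpleGraph V} {G' : SimpleGraph W} (f : G ≃g G') : M.hom G = M.hom G' := by
  classical
  unfold hom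
  refine Fintype.sum_equiv (f.toEquiv.arrowCongr (Equiv.refl Ω)) _ _ fun x => ?_
  congr 1
  · refine Finset.prod_bij (fun e _ => e.map f) ?_ ?_ ?_ ?_
    · intro e he
      induction e with | _ u v => simpa [f.map_adj_iff] using he
    · intro a _ b _ h
      exact Sym2.map.injective f.injective h
    · intro e he
      refine ⟨e.map f.symm, ?_, ?_⟩
      · induction e with | _ u v => simpa [f.symm.map_adj_iff] using he
      · induction e with | _ u v => simp
    · intro e _
      rw [edgeFactor_map]
      congr 1
      ext v
      exact congrArg x (f.symm_apply_apply v).symm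
  · exact Fintype.prod_equiv f.toEquiv _ _ fun v =>
      congrArg (fun z => M.weight (x z)) (f.symm_apply_apply v).symm

/-- `hom(K_{a,b}, H)`. -/
noncomputable def homBiclique [Fintype Ω] (M : SpinModel Ω) (a b : ℕ) : ℝ :=
  M.hom (completeBipartiteGraph (Fin a) (Fin b))

/-- `hom(K_n, H)`. -/
noncomputable def homClique [Fintype Ω] (M : SpinModel Ω) (n : ℕ) : ℝ :=
  M.hom (⊤ : SimpleGraph (Fin n))

theorem homBiclique_comm [Fintype Ω] (M : SpinModel Ω) (a b : ℕ) :
    M.homBiclique a b = M.homBiclique b a :=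
  M.hom_congr
    { toEquiv := Equiv.sumComm _ _
      map_rel_iff' := by
        rintro (u | u) (v | v) <;> simp [completeBipartiteGraph] }

open scoped Classical in
/-- The factor `hom(K_{d_u,d_v}, H)^{1/(d_u d_v)}` contributed by the unordered pair `e = uv`. -/
noncomputable def bicliqueFactor [Fintype Ω] (M : SpinModel Ω) {V : Type*} [Fintype V]
    (G : SimpleGraph V) (e : Sym2 V) : ℝ :=
  Sym2.lift ⟨fun u v => M.homBiclique (G.degree u) (G.degree v) ^
      (1 / ((G.degree u : ℝ) * (G.degree v : ℝ))), fun u v => by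
    beta_reduce
    rw [M.homBiclique_comm, mul_comm (G.degree u : ℝ)]⟩ e

open scoped Classical in
/-- `hom(G, H) ≤ ∏_{uv ∈ E(G)} hom(K_{d_u,d_v}, H)^{1/(d_u d_v)}` for every finite simple graph `G`
without isolated vertices. -/
def IsBicliqueMaximizing [Fintype Ω] (M : SpinModel Ω) : Prop :=
  ∀ (V : Type u) [Fintype V] (G : SimpleGraph V), (∀ v, ¬ G.IsIsolated v) →
    M.hom G ≤ ∏ e ∈ G.edgeFinset, M.bicliqueFactor G e

open scoped Classical in
/-- `hom(G, H) ≤ ∏_{v ∈ V(G)} hom(K_{d_v+1}, H)^{1/(d_v+1)}` for every finite simple graph `G`. -/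
def IsCliqueMaximizing [Fintype Ω] (M : SpinModel Ω) : Prop :=
  ∀ (V : Type u) [Fintype V] (G : SimpleGraph V),
    M.hom G ≤ ∏ v, M.homClique (G.degree v + 1) ^ (1 / ((G.degree v : ℝ) + 1))

theorem isHermitian_H (M : SpinModel Ω) : M.H.IsHermitian :=
  Matrix.IsHermitian.ext fun x y => by simpa using M.H_symm y x

/-- A model is ferromagnetic if its edge weight matrix is positive semidefinite. -/
def IsFerromagnetic (M : SpinModel Ω) : Prop :=
  M.H.PosSemidef

open scoped Classical in
/-- A model is antiferromagnetic if all eigenvalues of its edge weight matrix, counted with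
multiplicity, other than the largest one are nonpositive (`eigenvalues₀` lists the eigenvalues with
multiplicity in decreasing order). -/
def IsAntiferromagnetic [Fintype Ω] (M : SpinModel Ω) : Prop :=
  ∀ i : Fin (Fintype.card Ω), 0 < (i : ℕ) → M.isHermitian_H.eigenvalues₀ i ≤ 0

end SpinModel

open scoped NNReal

namespace SpinModel

/-! ### Hölder's inequality for finite weighted sums -/

/-! The spectral criteria are read off the trace and determinant of a symmetric nonnegative 2×2
matrix. Both partition function bounds are proved with arbitrary vertex weights, which may differ
from vertex to vertex. This makes induction possible: fixing the spin `s` of a vertex `w` removes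
its edges and multiplies the weights of its neighbors by `H s`. Taking `w` of maximal degree `c`,
one applies the induction hypothesis for each `s` and uses Hölder over the `c` neighbors. What
remains is a one-neighbor inequality, in which a pinned clique or biclique of a neighbor is raised
to a power and summed over `s`.

Ferromagnetic case (`graphSum_le`): positive semidefiniteness enters only as Cauchy-Schwarz for
nonnegative vectors, and any finite spin set is allowed. The one-neighbor inequality
`sum_mul_cliqueSum_rpow_le` combines a Hölder-type bound for cliques with one exceptional vertex
(`sum_mul_cliqueSum_pow_le`) with a comparison of cliques of consecutive sizes
(`cliqueSum_mul_pow_le`). The latter is the hard part: a system of inequalities that is linear after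
taking logarithms.

Antiferromagnetic case: for bipartite graphs the biclique bound holds for every symmetric
nonnegative `H`, by Hölder alone (`bipartiteSum_le`). A general `G` is reduced to its bipartite
double cover by `hom(G)^2 ≤ hom(G × K_2)` (`hom_sq_le`), the step that uses two spins and the sign
of the determinant. Every edge of `G` has two lifts with the same biclique factor, so a square root
finishes the proof. -/

theorem sum_mul_prod_rpow_le {ι κ : Type*} (s : Finset ι) (t : Finset κ) (μ : κ → ℝ≥0)
    (f : ι → κ → ℝ≥0) (w : ι → ℝ) (hw : ∀ i ∈ s, 0 ≤ w i) (hw1 : ∑ i ∈ s, w i = 1) :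
    ∑ k ∈ t, μ k * ∏ i ∈ s, f i k ^ w i ≤ ∏ i ∈ s, (∑ k ∈ t, μ k * f i k) ^ w i := by
  set S : ι → ℝ≥0 := fun i => ∑ k ∈ t, μ k * f i k with hS
  -- A zero `S i` with nonzero exponent kills the left side; with exponent zero it only contributes
  -- `0 ^ 0 = 1`. Otherwise normalize by the `S i` and apply weighted AM-GM.
  by_cases h0 : ∃ i ∈ s, S i = 0 ∧ w i ≠ 0
  · obtain ⟨i, hi, hSi, hwi⟩ := h0
    refine (Finset.sum_eq_zero fun k hk => ?_).trans_le zero_le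
    have h := (Finset.sum_eq_zero_iff.1 hSi) k hk
    rcases mul_eq_zero.1 h with h | h
    · rw [h, zero_mul]
    · rw [Finset.prod_eq_zero hi, mul_zero]
      rw [h, NNReal.zero_rpow hwi]
  · push Not at h0
    have hfac : ∀ k, ∏ i ∈ s, f i k ^ w i
        = (∏ i ∈ s, S i ^ w i) * ∏ i ∈ s, (f i k / S i) ^ w i := by
      intro k
      rw [← Finset.prod_mul_distrib]
      refine Finset.prod_congr rfl fun i hi => ?_
      by_cases hSi : S i = 0
      · simp [h0 i hi hSi]
      · rw [← NNReal.mul_rpow, mul_div_cancel₀ _ hSi]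
    have hw1' : ∑ i ∈ s, (w i).toNNReal = 1 := by
      rw [← NNReal.coe_inj]
      push_cast
      rw [← hw1]
      exact Finset.sum_congr rfl fun i hi => Real.coe_toNNReal _ (hw i hi)
    have ham : ∀ k, ∏ i ∈ s, (f i k / S i) ^ w i ≤ ∑ i ∈ s, (w i).toNNReal * (f i k / S i) := by
      intro k
      refine le_trans (le_of_eq ?_)
        (NNReal.geom_mean_le_arith_mean_weighted s (fun i => (w i).toNNReal) _ hw1')
      exact Finset.prod_congr rfl fun i hi => by rw [Real.coe_toNNReal _ (hw i hi)]
    calc ∑ k ∈ t, μ k * ∏ i ∈ s, f i k ^ w i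
        = (∏ i ∈ s, S i ^ w i) * ∑ k ∈ t, μ k * ∏ i ∈ s, (f i k / S i) ^ w i := by
          rw [Finset.mul_sum]
          refine Finset.sum_congr rfl fun k _ => ?_
          rw [hfac]; ring
      _ ≤ (∏ i ∈ s, S i ^ w i) * ∑ k ∈ t, μ k * ∑ i ∈ s, (w i).toNNReal * (f i k / S i) := by
          gcongr with k _
          exact ham k
      _ = (∏ i ∈ s, S i ^ w i) * ∑ i ∈ s, (w i).toNNReal * (S i / S i) := by
          congr 1
          simp_rw [Finset.mul_sum]
          rw [Finset.sum_comm]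
          refine Finset.sum_congr rfl fun i _ => ?_
          rw [hS]
          simp only
          rw [div_eq_mul_inv, Finset.sum_mul, Finset.mul_sum]
          refine Finset.sum_congr rfl fun k _ => ?_
          rw [div_eq_mul_inv]; ring
      _ ≤ (∏ i ∈ s, S i ^ w i) * ∑ i ∈ s, (w i).toNNReal * 1 := by
          gcongr with i _
          exact div_self_le_one _
      _ = ∏ i ∈ s, S i ^ w i := by simp [hw1']

theorem sum_mul_rpow_mul_rpow_le {κ : Type*} (t : Finset κ) (μ f g : κ → ℝ≥0) {a b : ℝ}
    (ha : 0 ≤ a) (hb : 0 ≤ b) (hab : a + b = 1) :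
    ∑ k ∈ t, μ k * (f k ^ a * g k ^ b) ≤
      (∑ k ∈ t, μ k * f k) ^ a * (∑ k ∈ t, μ k * g k) ^ b := by
  have := sum_mul_prod_rpow_le Finset.univ t μ ![f, g] ![a, b]
    (by intro i _; fin_cases i <;> simpa) (by simpa using hab)
  simpa [Fin.prod_univ_succ] using this

theorem sum_mul_rpow_mul_rpow_mul_rpow_le {κ : Type*} (t : Finset κ) (μ f g h : κ → ℝ≥0)
    {a b c : ℝ} (ha : 0 ≤ a) (hb : 0 ≤ b) (hc : 0 ≤ c) (habc : a + b + c = 1) :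
    ∑ k ∈ t, μ k * (f k ^ a * g k ^ b * h k ^ c) ≤
      (∑ k ∈ t, μ k * f k) ^ a * (∑ k ∈ t, μ k * g k) ^ b * (∑ k ∈ t, μ k * h k) ^ c := by
  have := sum_mul_prod_rpow_le Finset.univ t μ ![f, g, h] ![a, b, c]
    (by intro i _; fin_cases i <;> simpa) (by simpa [Fin.sum_univ_succ, add_assoc] using habc)
  simpa [Fin.prod_univ_succ, mul_assoc] using this

theorem le_rpow_mul_rpow_of_pow_le {a b c : ℝ≥0} {m : ℕ} (hm : m ≠ 0) {p q : ℕ}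
    (h : a ^ m ≤ b ^ p * c ^ q) :
    a ≤ b ^ ((p : ℝ) / m) * c ^ ((q : ℝ) / m) := by
  have hm' : (0 : ℝ) < m := by positivity
  have h1 : (a ^ m) ^ ((1 : ℝ) / m) ≤ (b ^ p * c ^ q) ^ ((1 : ℝ) / m) :=
    NNReal.rpow_le_rpow h (by positivity)
  rw [NNReal.mul_rpow, ← NNReal.rpow_natCast, ← NNReal.rpow_natCast, ← NNReal.rpow_natCast,
    ← NNReal.rpow_mul, ← NNReal.rpow_mul, ← NNReal.rpow_mul, mul_one_div_cancel hm'.ne',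
    NNReal.rpow_one, mul_one_div, mul_one_div] at h1
  exact h1

theorem rpow_div_pow {a : ℝ≥0} {m : ℕ} (hm : m ≠ 0) (p : ℕ) : (a ^ ((p : ℝ) / m)) ^ m = a ^ p := by
  have hm' : (m : ℝ) ≠ 0 := by positivity
  rw [← NNReal.rpow_natCast, ← NNReal.rpow_mul, div_mul_cancel₀ _ hm', NNReal.rpow_natCast]

theorem rpow_div_mul_rpow_div_mul_rpow_div_pow {a b c : ℝ≥0} {m : ℕ} (hm : m ≠ 0) (p q r : ℕ) :
    (a ^ ((p : ℝ) / m) * b ^ ((q : ℝ) / m) * c ^ ((r : ℝ) / m)) ^ m = a ^ p * b ^ q * c ^ r := by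
  rw [mul_pow, mul_pow, rpow_div_pow hm, rpow_div_pow hm, rpow_div_pow hm]

/-- Hölder's inequality with integer exponents. -/
theorem sum_mul_pow_le {κ : Type*} (t : Finset κ) (μ A B C : κ → ℝ≥0) (n : ℕ)
    (h : ∀ k ∈ t, A k ^ (n + 1) ≤ B k * C k ^ n) :
    (∑ k ∈ t, μ k * A k) ^ (n + 1) ≤ (∑ k ∈ t, μ k * B k) * (∑ k ∈ t, μ k * C k) ^ n := by
  have h1 : ∑ k ∈ t, μ k * A k ≤
      (∑ k ∈ t, μ k * B k) ^ (((1 : ℕ) : ℝ) / (n + 1 : ℕ)) *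
        (∑ k ∈ t, μ k * C k) ^ ((n : ℝ) / (n + 1 : ℕ)) := by
    refine le_trans (Finset.sum_le_sum fun k hk => ?_)
      (sum_mul_rpow_mul_rpow_le t μ B C (by positivity) (by positivity) ?_)
    · gcongr
      exact le_rpow_mul_rpow_of_pow_le n.succ_ne_zero (by simpa using h k hk)
    · push_cast; field_simp; ring
  calc _ ≤ _ := pow_le_pow_left₀ zero_le h1 (n + 1)
    _ = _ := by
      rw [mul_pow, rpow_div_pow n.succ_ne_zero, rpow_div_pow n.succ_ne_zero, pow_one]

/-! ### Weighted clique sums -/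

section CliqueSum

variable {Ω : Type w} [Fintype Ω]

/-- The partition function of a clique on `n` vertices, all with vertex weights `ω`. -/
def cliqueSum (H : Ω → Ω → ℝ≥0) : ℕ → (Ω → ℝ≥0) → ℝ≥0
  | 0, _ => 1
  | n + 1, ω => ∑ s, ω s * cliqueSum H n (fun x => ω x * H s x)

/-- The Cauchy-Schwarz inequality for the bilinear form of `H` on nonnegative vectors. -/
def CauchySchwarz (H : Ω → Ω → ℝ≥0) : Prop :=
  ∀ a b : Ω → ℝ≥0, (∑ x, ∑ y, a x * b y * H x y) ^ 2 ≤
    (∑ x, ∑ y, a x * a y * H x y) * ∑ x, ∑ y, b x * b y * H x y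

theorem cliqueSum_one (H : Ω → Ω → ℝ≥0) (ω : Ω → ℝ≥0) : cliqueSum H 1 ω = ∑ s, ω s := by
  simp [cliqueSum]

theorem cliqueSum_two (H : Ω → Ω → ℝ≥0) (ω : Ω → ℝ≥0) :
    cliqueSum H 2 ω = ∑ x, ∑ y, ω x * ω y * H x y := by
  simp [cliqueSum, Finset.mul_sum, mul_assoc]

/-- Both sides are a clique with one `ω₀`-vertex and `n + 1` `ω`-vertices; the right side conditions
on the spin of an `ω`-vertex first. -/
theorem sum_mul_cliqueSum_succ (H : Ω → Ω → ℝ≥0) (hs : ∀ x y, H x y = H y x)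
    (n : ℕ) (ω₀ ω : Ω → ℝ≥0) :
    ∑ s, ω₀ s * cliqueSum H (n + 1) (fun x => ω x * H s x) =
      ∑ y, ω y * ∑ s, ω₀ s * H y s * cliqueSum H n (fun x => ω x * H y x * H s x) := by
  simp_rw [cliqueSum, Finset.mul_sum]
  rw [Finset.sum_comm]
  refine Finset.sum_congr rfl fun y _ => Finset.sum_congr rfl fun s _ => ?_
  rw [hs y s]
  have : (fun x => ω x * H s x * H y x) = fun x => ω x * H y x * H s x := by
    funext x; ring
  rw [this]; ring

/-- Let `G` be the clique with one `ω₀`-vertex and the rest `ω`, and `G'` the same with the roles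
exchanged. Conditioning on an `ω`-vertex, the induction hypothesis and Hölder bound `G` by `G'` and
the pure `ω`-clique. Exchanging the weights bounds `G'` by `G`, and `G'` is eliminated. -/
theorem sum_mul_cliqueSum_pow_le (H : Ω → Ω → ℝ≥0) (hs : ∀ x y, H x y = H y x)
    (hP : CauchySchwarz H) (n : ℕ) (ω₀ ω : Ω → ℝ≥0) :
    (∑ s, ω₀ s * cliqueSum H n (fun x => ω x * H s x)) ^ (n + 1) ≤
      cliqueSum H (n + 1) ω₀ * cliqueSum H (n + 1) ω ^ n := by
  induction n generalizing ω₀ ω with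
  | zero => simp [cliqueSum]
  | succ n ih =>
    -- Eliminating `G'` ends with an `n`-th root, so the single edge is separate: there the claim is
    -- Cauchy-Schwarz itself.
    rcases Nat.eq_zero_or_pos n with rfl | hn
    · rw [cliqueSum_two, cliqueSum_two, pow_one]
      refine le_trans (le_of_eq ?_) (hP ω₀ ω)
      simp [cliqueSum, Finset.mul_sum, mul_assoc]
    · have key : ∀ ω₀ ω : Ω → ℝ≥0,
          (∑ s, ω₀ s * cliqueSum H (n + 1) (fun x => ω x * H s x)) ^ (n + 1) ≤
          (∑ s, ω s * cliqueSum H (n + 1) (fun x => ω₀ x * H s x)) *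
            cliqueSum H (n + 2) ω ^ n := by
        intro ω₀ ω
        rw [sum_mul_cliqueSum_succ H hs]
        exact sum_mul_pow_le _ ω _ _ _ n fun y _ => ih _ _
      set G := ∑ s, ω₀ s * cliqueSum H (n + 1) (fun x => ω x * H s x) with hG
      set G' := ∑ s, ω s * cliqueSum H (n + 1) (fun x => ω₀ x * H s x) with hG'
      have h1 : G ^ (n + 1) ≤ G' * cliqueSum H (n + 2) ω ^ n := key ω₀ ω
      have h2 : G' ^ (n + 1) ≤ G * cliqueSum H (n + 2) ω₀ ^ n := key ω ω₀
      rcases eq_or_ne G 0 with h0 | h0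
      · rw [h0, zero_pow (by omega)]; exact zero_le
      refine le_of_pow_le_pow_left₀ hn.ne' zero_le ?_
      refine le_of_mul_le_mul_left ?_ (pos_iff_ne_zero.2 h0)
      calc G * (G ^ (n + 1 + 1)) ^ n = (G ^ (n + 1)) ^ (n + 1) := by ring
        _ ≤ (G' * cliqueSum H (n + 2) ω ^ n) ^ (n + 1) := by gcongr
        _ = G' ^ (n + 1) * (cliqueSum H (n + 2) ω ^ n) ^ (n + 1) := mul_pow _ _ _
        _ ≤ (G * cliqueSum H (n + 2) ω₀ ^ n) * (cliqueSum H (n + 2) ω ^ n) ^ (n + 1) := by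
          gcongr
        _ = _ := by ring

/-- Conditioning on a clique vertex `z` absorbs `H z` into `a` and `μ`, and Cauchy-Schwarz over `z`
carries the induction; with no clique vertices left it is the hypothesis on `H` for `a` and `g`. For
`a = μ` the first factor on the right is the clique on `n + 2` vertices. -/
theorem sum_mul_cliqueSum_sq_le (H : Ω → Ω → ℝ≥0) (hs : ∀ x y, H x y = H y x)
    (hP : CauchySchwarz H) (g : Ω → ℝ≥0) (n : ℕ) (a μ ψ : Ω → ℝ≥0) :
    (∑ x, a x * (∑ y, g y * H x y) * cliqueSum H n (fun z => μ z * ψ z * H x z)) ^ 2 ≤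
      (∑ x, ∑ y, a x * a y * H x y * cliqueSum H n (fun z => μ z * H x z * H y z)) *
        ((∑ x, ∑ y, g x * g y * H x y) * cliqueSum H n (fun z => μ z * ψ z ^ 2)) := by
  induction n generalizing a μ with
  | zero =>
    simpa [cliqueSum, Finset.mul_sum, mul_assoc] using hP a g
  | succ n ih =>
    have e1 : ∑ x, a x * (∑ y, g y * H x y) * cliqueSum H (n + 1) (fun z => μ z * ψ z * H x z) =
        ∑ y, μ y * (ψ y * ∑ x, a x * H y x * (∑ y, g y * H x y) *
          cliqueSum H n (fun z => μ z * H y z * ψ z * H x z)) := by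
      rw [sum_mul_cliqueSum_succ H hs]
      refine Finset.sum_congr rfl fun y _ => ?_
      rw [mul_assoc]
      congr 2
      refine Finset.sum_congr rfl fun x _ => ?_
      congr 1
      · ring
      · congr 1; funext z; ring
    have e2 : ∑ x, ∑ y, a x * a y * H x y *
          cliqueSum H (n + 1) (fun z => μ z * H x z * H y z) =
        ∑ z, μ z * ∑ x, ∑ y, a x * H z x * (a y * H z y) * H x y *
          cliqueSum H n (fun t => μ t * H z t * H x t * H y t) := by
      simp_rw [cliqueSum, Finset.mul_sum]
      refine (Finset.sum_congr rfl fun x _ => Finset.sum_comm).trans (Finset.sum_comm.trans ?_)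
      refine Finset.sum_congr rfl fun z _ => Finset.sum_congr rfl fun x _ =>
        Finset.sum_congr rfl fun y _ => ?_
      have : (fun t => μ t * H x t * H y t * H z t) =
          fun t => μ t * H z t * H x t * H y t := by
        funext t; ring
      rw [this, hs z x, hs z y]; ring
    rw [e1, e2]
    refine (sum_mul_pow_le Finset.univ μ _
      (fun z => ∑ x, ∑ y, a x * H z x * (a y * H z y) * H x y *
          cliqueSum H n (fun t => μ t * H z t * H x t * H y t))
      (fun z => (∑ x, ∑ y, g x * g y * H x y) *
        (ψ z ^ 2 * cliqueSum H n (fun t => μ t * H z t * ψ t ^ 2))) 1 fun z _ => ?_).trans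
          (le_of_eq ?_)
    · rw [pow_one, mul_pow]
      calc _ ≤ ψ z ^ 2 * _ := mul_le_mul_right (ih (fun x => a x * H z x) (fun t => μ t * H z t)) _
        _ = _ := by ring
    · rw [pow_one, cliqueSum]
      congr 1
      rw [Finset.mul_sum]
      refine Finset.sum_congr rfl fun z _ => ?_
      have : (fun t => μ t * H z t * ψ t ^ 2) = fun t => μ t * ψ t ^ 2 * H z t := by
        funext t; ring
      rw [this]; ring

/-- The elimination step of `cliqueSum_mul_pow_le`. If `S ≠ 0`, the hypotheses successively force
all other quantities to be nonzero, and after taking logarithms a linear combination gives the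
claim. -/
theorem cliqueSum_mul_pow_le_aux {a a' S S' x t p p' : ℝ≥0} {n : ℕ}
    (hA : S ^ (n + 2) ≤ a * a' ^ (n + 1)) (hB : a' ^ (n + 2) ≤ S' * S ^ (n + 1))
    (hC : S' ^ (2 * (n + 2)) ≤ x ^ (n + 2) * t ^ n * a' ^ 2)
    (hD : x ^ 2 ≤ t ^ 2 * p * p')
    (hE : p ^ (n + 2) ≤ a ^ (n + 2) * S ^ n) (hE' : p' ^ (n + 2) ≤ a' ^ (n + 2) * S' ^ n) :
    S ^ (n + 3) ≤ a ^ (n + 3) * t ^ (n + 1) := by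
  rcases eq_or_ne S 0 with h0 | h0
  · rw [h0, zero_pow (by omega)]; exact zero_le
  have hp : ∀ {y z : ℝ≥0}, y ≤ z → y ≠ 0 → z ≠ 0 := fun h hy hz => hy (by simpa [hz] using h)
  have h1 := hp hA (pow_ne_zero _ h0)
  have ha : a ≠ 0 := left_ne_zero_of_mul h1
  have ha' : a' ≠ 0 := fun h => right_ne_zero_of_mul h1 (by simp [h])
  have h2 := hp hB (pow_ne_zero _ ha')
  have hS' : S' ≠ 0 := left_ne_zero_of_mul h2
  have h3 := hp hC (pow_ne_zero _ hS')
  have hx : x ≠ 0 := fun h => left_ne_zero_of_mul (left_ne_zero_of_mul h3) (by simp [h])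
  have h4 := hp hD (pow_ne_zero _ hx)
  have ht : t ≠ 0 := fun h => left_ne_zero_of_mul (left_ne_zero_of_mul h4) (by simp [h])
  have hp0 : p ≠ 0 := right_ne_zero_of_mul (left_ne_zero_of_mul h4)
  have hp'0 : p' ≠ 0 := right_ne_zero_of_mul h4
  have tolog : ∀ {y z : ℝ≥0}, y ≤ z → y ≠ 0 → Real.log y ≤ Real.log z := fun h hy =>
    Real.log_le_log (NNReal.coe_pos.2 (pos_iff_ne_zero.2 hy)) (NNReal.coe_le_coe.2 h)
  have cne : ∀ {y : ℝ≥0}, y ≠ 0 → (y : ℝ) ≠ 0 := fun h => NNReal.coe_ne_zero.2 h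
  have lA := tolog hA (pow_ne_zero _ h0)
  have lB := tolog hB (pow_ne_zero _ ha')
  have lC := tolog hC (pow_ne_zero _ hS')
  have lD := tolog hD (pow_ne_zero _ hx)
  have lE := tolog hE (pow_ne_zero _ hp0)
  have lE' := tolog hE' (pow_ne_zero _ hp'0)
  push_cast at lA lB lC lD lE lE'
  have c1 := cne h0
  have c2 := cne ha
  have c3 := cne ha'
  have c4 := cne hS'
  have c5 := cne hx
  have c6 := cne ht
  have c7 := cne hp0
  have c8 := cne hp'0
  rw [Real.log_mul (by positivity) (by positivity)] at lA lB lE lE'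
  rw [Real.log_mul (by positivity) (by positivity),
    Real.log_mul (by positivity) (by positivity)] at lC lD
  simp only [Real.log_pow] at lA lB lC lD lE lE'
  push_cast at lA lB lC lD lE lE'
  rw [← NNReal.coe_le_coe]
  push_cast
  rw [← Real.log_le_log_iff (by positivity) (by positivity),
    Real.log_mul (by positivity) (by positivity), Real.log_pow, Real.log_pow, Real.log_pow]
  push_cast
  set A := Real.log a
  set A' := Real.log a'
  set L := Real.log S
  set L' := Real.log S'
  set X := Real.log x
  set T := Real.log t
  set q := Real.log p
  set q' := Real.log p'
  have hn : (0 : ℝ) ≤ n := n.cast_nonneg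
  -- Eliminates `X`, `q` and `q'`: twice `lC`, plus `n + 2` times `lD`, plus `lE` and `lE'`.
  have f1 : (3 * (n + 1) + 5 : ℝ) * L' ≤ 4 * (n + 1) * T + (n + 2) * A + (n + 6) * A' + n * L := by
    have := mul_le_mul_of_nonneg_left lD (by positivity : (0 : ℝ) ≤ n + 2)
    linarith
  -- Eliminates `L'` through `lB`. Adding `n + 1` times this to `f3` cancels `A'` and leaves four
  -- times the goal.
  have f2 : (3 * (n + 1) ^ 2 + 7 * (n + 1) : ℝ) * A' ≤
      4 * (n + 1) * T + (n + 2) * A + (3 * (n + 1) ^ 2 + 6 * (n + 1) - 1) * L := by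
    have := mul_le_mul_of_nonneg_left lB (by positivity : (0 : ℝ) ≤ 3 * (n + 1) + 5)
    linarith
  have f3 := mul_le_mul_of_nonneg_left lA (by positivity : (0 : ℝ) ≤ 3 * (n + 1) + 7)
  linarith

/-- A comparison of cliques with `n + 1` and `n + 2` vertices. -/
theorem cliqueSum_mul_pow_le (H : Ω → Ω → ℝ≥0) (hs : ∀ x y, H x y = H y x)
    (hP : CauchySchwarz H) (n : ℕ) (μ ψ : Ω → ℝ≥0) :
    cliqueSum H (n + 1) (fun x => μ x * ψ x) ^ (n + 2) ≤
      (∑ x, μ x * ψ x ^ (n + 1)) ^ (n + 2) * cliqueSum H (n + 2) μ ^ n := by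
  induction n generalizing μ ψ with
  | zero => simp [cliqueSum]
  | succ n ih =>
    let F : (Ω → ℝ≥0) → Ω → ℝ≥0 := fun ψ x => cliqueSum H (n + 1) (fun z => μ z * ψ z * H x z)
    have hT : ∀ ψ, cliqueSum H (n + 2) (fun x => μ x * ψ x) = ∑ x, μ x * ψ x * F ψ x :=
      fun ψ => rfl
    have hm : ∀ ψ θ : Ω → ℝ≥0,
        (∑ x, μ x * ψ x * F θ x) ^ (n + 2) ≤ cliqueSum H (n + 2) (fun x => μ x * ψ x) *
          cliqueSum H (n + 2) (fun x => μ x * θ x) ^ (n + 1) := fun ψ θ =>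
      sum_mul_cliqueSum_pow_le H hs hP (n + 1) (fun x => μ x * ψ x) (fun x => μ x * θ x)
    -- replacing one edge by a product
    have hD : ∀ g ψ : Ω → ℝ≥0, (∑ x, μ x * (∑ y, g y * H x y) * F ψ x) ^ 2 ≤
        cliqueSum H (n + 3) μ * ((∑ x, ∑ y, g x * g y * H x y) *
          cliqueSum H (n + 1) (fun z => μ z * ψ z ^ 2)) := by
      intro g ψ
      refine (sum_mul_cliqueSum_sq_le H hs hP g (n + 1) μ μ ψ).trans (le_of_eq ?_)
      congr 1
      simp_rw [cliqueSum, Finset.mul_sum, mul_assoc]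
    have hE : ∀ ψ : Ω → ℝ≥0, cliqueSum H (n + 1) (fun z => μ z * ψ z ^ 2) ^ (n + 2) ≤
        (∑ x, μ x * ψ x ^ (n + 2)) ^ (n + 2) *
          cliqueSum H (n + 2) (fun x => μ x * ψ x) ^ n := by
      intro ψ
      have := ih (fun x => μ x * ψ x) ψ
      simp only [mul_assoc, ← pow_succ', ← pow_two] at this
      exact this
    -- One of the two halves of `F ψ x = F ψ x ^ (1/2) * F ψ x ^ (1/2)` is bounded by the induction
    -- hypothesis with `x` pinned; then Hölder with three factors is applied to the sum over `x`.
    have hC : ∀ ψ : Ω → ℝ≥0, cliqueSum H (n + 2) (fun x => μ x * ψ x) ^ (2 * (n + 2)) ≤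
        (∑ x, μ x * (∑ y, μ y * ψ y ^ (n + 1) * H x y) * F ψ x) ^ (n + 2) *
          cliqueSum H (n + 3) μ ^ n * (∑ x, μ x * ψ x ^ (n + 2)) ^ 2 := by
      intro ψ
      have hF : ∀ x, F ψ x ≤ (∑ y, μ y * ψ y ^ (n + 1) * H x y) *
          cliqueSum H (n + 2) (fun z => μ z * H x z) ^ ((n : ℝ) / (n + 2 : ℕ)) := by
        intro x
        have h1 := ih (fun z => μ z * H x z) ψ
        have h2 := le_rpow_mul_rpow_of_pow_le (by omega) h1
        rw [div_self (by positivity), NNReal.rpow_one] at h2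
        refine le_trans (le_of_eq ?_) (h2.trans (le_of_eq ?_))
        · change cliqueSum _ _ _ = _
          congr 1; funext z; ring
        · congr 1
          exact Finset.sum_congr rfl fun y _ => by ring
      have h1 : cliqueSum H (n + 2) (fun x => μ x * ψ x) ≤
          (∑ x, μ x * ((∑ y, μ y * ψ y ^ (n + 1) * H x y) * F ψ x)) ^
              (((n + 2 : ℕ) : ℝ) / (2 * (n + 2) : ℕ)) *
            (∑ x, μ x * cliqueSum H (n + 2) (fun z => μ z * H x z)) ^
              ((n : ℝ) / (2 * (n + 2) : ℕ)) *
            (∑ x, μ x * ψ x ^ (n + 2)) ^ (((2 : ℕ) : ℝ) / (2 * (n + 2) : ℕ)) := by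
        refine le_trans ?_ (sum_mul_rpow_mul_rpow_mul_rpow_le Finset.univ μ _ _ _
          (by positivity) (by positivity) (by positivity) ?_)
        · rw [hT]
          refine Finset.sum_le_sum fun x _ => ?_
          rw [mul_assoc]
          refine mul_le_mul_right ?_ _
          refine le_of_pow_le_pow_left₀ (n := 2 * (n + 2)) (by omega) zero_le ?_
          rw [rpow_div_mul_rpow_div_mul_rpow_div_pow (by omega)]
          have h3 := pow_le_pow_left₀ zero_le (hF x) (n + 2)
          rw [mul_pow, rpow_div_pow (by omega)] at h3
          calc (ψ x * F ψ x) ^ (2 * (n + 2))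
              = (ψ x ^ (n + 2)) ^ 2 * (F ψ x ^ (n + 2) * F ψ x ^ (n + 2)) := by ring
            _ ≤ (ψ x ^ (n + 2)) ^ 2 * (((∑ y, μ y * ψ y ^ (n + 1) * H x y) ^ (n + 2) *
                cliqueSum H (n + 2) (fun z => μ z * H x z) ^ n) * F ψ x ^ (n + 2)) := by
              gcongr
            _ = _ := by ring
        · push_cast; field_simp; ring
      refine (pow_le_pow_left₀ zero_le h1 (2 * (n + 2))).trans (le_of_eq ?_)
      rw [rpow_div_mul_rpow_div_mul_rpow_div_pow (by omega)]
      congr 3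
      exact Finset.sum_congr rfl fun x _ => by ring
    -- `θ` is the equality case of Hölder for `∑ μ ψ F`, where `F = F ψ = θ ^ (n + 1)`. It serves as
    -- a second test function, coupled to `ψ` by the bounds below.
    let θ : Ω → ℝ≥0 := fun x => F ψ x ^ (((1 : ℕ) : ℝ) / (n + 1 : ℕ))
    have hθ : ∀ x, θ x ^ (n + 1) = F ψ x := fun x => by
      rw [rpow_div_pow n.succ_ne_zero, pow_one]
    refine cliqueSum_mul_pow_le_aux (a' := ∑ x, μ x * θ x ^ (n + 2)) ?_ ?_ (hC θ) ?_ (hE ψ) (hE θ)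
    · rw [hT]
      simp_rw [mul_assoc]
      refine sum_mul_pow_le _ _ _ _ _ _ fun x _ => le_of_eq ?_
      rw [← hθ]; ring
    · refine le_trans (le_of_eq ?_) (hm θ ψ)
      congr 1
      refine Finset.sum_congr rfl fun x _ => ?_
      rw [← hθ]; ring
    · have e : ∀ x, ∑ y, μ y * θ y ^ (n + 1) * H x y = ∑ y, μ y * F ψ y * H x y := fun x =>
        Finset.sum_congr rfl fun y _ => by rw [hθ]
      simp_rw [e]
      -- `κ` is the quadratic form of `H` at `μ F ψ`. Taking `g = μ F ψ` in `hD`, the function `ψ`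
      -- gives `κ ^ 2` on the left and hence, after cancelling, a bound on `κ`; this feeds into the
      -- bound for `θ`.
      set κ := ∑ x, ∑ y, μ x * F ψ x * (μ y * F ψ y) * H x y with hκ
      have h1 := hD (fun x => μ x * F ψ x) ψ
      have h2 := hD (fun x => μ x * F ψ x) θ
      rw [← hκ] at h1 h2
      have h3 : ∑ x, μ x * (∑ y, μ y * F ψ y * H x y) * F ψ x = κ := by
        rw [hκ]
        refine Finset.sum_congr rfl fun x _ => ?_
        rw [Finset.mul_sum, Finset.sum_mul]
        exact Finset.sum_congr rfl fun y _ => by ring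
      rw [h3] at h1
      have h4 : κ ≤ cliqueSum H (n + 3) μ * cliqueSum H (n + 1) (fun z => μ z * ψ z ^ 2) := by
        rcases eq_or_ne κ 0 with h0 | h0
        · rw [h0]; exact zero_le
        · refine le_of_mul_le_mul_left ?_ (pos_iff_ne_zero.2 h0)
          calc κ * κ = κ ^ 2 := by ring
            _ ≤ _ := h1
            _ = _ := by ring
      refine h2.trans ?_
      calc _ ≤ cliqueSum H (n + 3) μ * (cliqueSum H (n + 3) μ *
            cliqueSum H (n + 1) (fun z => μ z * ψ z ^ 2) *
              cliqueSum H (n + 1) (fun z => μ z * θ z ^ 2)) := by gcongr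
        _ = _ := by ring

/-- Iterates `cliqueSum_mul_pow_le`, moving one factor `ψ` out of the weights each time; the moment
of order `n + j` is the same at every step. -/
theorem cliqueSum_mul_pow_pow_le (H : Ω → Ω → ℝ≥0) (hs : ∀ x y, H x y = H y x)
    (hP : CauchySchwarz H) (j n : ℕ) (ω ψ : Ω → ℝ≥0) :
    cliqueSum H (n + 1) (fun x => ω x * ψ x ^ j) ^ ((n + j) * (n + j + 1)) ≤
      (∑ x, ω x * ψ x ^ (n + j)) ^ ((n + 1) * j * (n + j + 1)) *
        cliqueSum H (n + j + 1) ω ^ (n * (n + 1)) := by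
  induction j generalizing n with
  | zero => simp
  | succ j ih =>
    have h1 := cliqueSum_mul_pow_le H hs hP n (fun x => ω x * ψ x ^ j) ψ
    simp only [mul_assoc, ← pow_succ, ← pow_add] at h1
    have h2 := ih (n + 1)
    rw [show j + (n + 1) = n + (j + 1) by ring] at h1
    rw [show n + 1 + j = n + (j + 1) by ring] at h2
    set S := ∑ x, ω x * ψ x ^ (n + (j + 1))
    set c := n + (j + 1) with hc
    refine le_of_pow_le_pow_left₀ (n := n + 2) (by omega) zero_le ?_
    calc (cliqueSum H (n + 1) (fun x => ω x * ψ x ^ (j + 1)) ^ (c * (c + 1))) ^ (n + 2)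
        = (cliqueSum H (n + 1) (fun x => ω x * ψ x ^ (j + 1)) ^ (n + 2)) ^ (c * (c + 1)) := by
          rw [← pow_mul, ← pow_mul, mul_comm]
      _ ≤ (S ^ (n + 2) * cliqueSum H (n + 2) (fun x => ω x * ψ x ^ j) ^ n) ^ (c * (c + 1)) := by
          gcongr
      _ = S ^ ((n + 2) * (c * (c + 1))) *
          (cliqueSum H (n + 2) (fun x => ω x * ψ x ^ j) ^ (c * (c + 1))) ^ n := by
          rw [mul_pow, ← pow_mul, ← pow_mul, ← pow_mul, mul_comm n]
      _ ≤ S ^ ((n + 2) * (c * (c + 1))) *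
          (S ^ ((n + 1 + 1) * j * (c + 1)) * cliqueSum H (c + 1) ω ^ ((n + 1) * (n + 1 + 1))) ^ n := by
          gcongr
      _ = _ := by
          rw [mul_pow, mul_pow, ← pow_mul, ← pow_mul, ← pow_mul, ← pow_mul, ← mul_assoc, ← pow_add]
          congr 2
          · rw [hc]; ring
          · ring

/-- The one-neighbor inequality. With `F = ψ ^ n` and `j = c - n`, the left side `X` is a clique
with exceptional weight `ω₀ ψ ^ j`. The resulting `cliqueSum` of `ω₀ ψ ^ j` is compared with the
larger clique at the cost of a power of `X`, which cancels. -/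
theorem sum_mul_cliqueSum_rpow_le (H : Ω → Ω → ℝ≥0) (hs : ∀ x y, H x y = H y x)
    (hP : CauchySchwarz H) {n c : ℕ} (hn : 0 < n) (hc : n ≤ c) (ω₀ ω : Ω → ℝ≥0) :
    ∑ s, ω₀ s * cliqueSum H n (fun x => ω x * H s x) ^ ((c : ℝ) / n) ≤
      cliqueSum H (c + 1) ω₀ ^ (1 / ((c : ℝ) + 1)) *
        cliqueSum H (n + 1) ω ^ ((c : ℝ) / ((n : ℝ) + 1)) := by
  obtain ⟨j, rfl⟩ := Nat.exists_eq_add_of_le hc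
  set c := n + j with hcdef
  set F : Ω → ℝ≥0 := fun s => cliqueSum H n (fun x => ω x * H s x) with hF
  let ψ : Ω → ℝ≥0 := fun s => F s ^ (((1 : ℕ) : ℝ) / n)
  have hψ : ∀ s, ψ s ^ n = F s := fun s => by rw [rpow_div_pow hn.ne', pow_one]
  have hψc : ∀ s, F s ^ ((c : ℝ) / n) = ψ s ^ c := fun s => by
    rw [← NNReal.rpow_natCast, ← NNReal.rpow_mul]
    congr 1
    push_cast; ring
  set X := ∑ s, ω₀ s * ψ s ^ c with hX
  have hgoal : X ^ ((n + 1) * (c + 1)) ≤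
      cliqueSum H (c + 1) ω₀ ^ (n + 1) * cliqueSum H (n + 1) ω ^ (c * (c + 1)) := by
    rcases eq_or_ne X 0 with h0 | h0
    · rw [h0, zero_pow (by positivity)]; exact zero_le
    have h1 := sum_mul_cliqueSum_pow_le H hs hP n (fun x => ω₀ x * ψ x ^ j) ω
    have e1 : ∑ s, ω₀ s * ψ s ^ j * cliqueSum H n (fun x => ω x * H s x) = X := by
      refine Finset.sum_congr rfl fun s _ => ?_
      change _ * F s = _
      rw [← hψ, hcdef, pow_add]; ring
    rw [e1] at h1
    have h2 := cliqueSum_mul_pow_pow_le H hs hP j n ω₀ ψ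
    rw [← hcdef, ← hX] at h2
    refine le_of_pow_le_pow_left₀ (n := n) hn.ne' zero_le ?_
    refine le_of_mul_le_mul_left ?_ (pos_iff_ne_zero.2 (pow_ne_zero ((n + 1) * j * (c + 1)) h0))
    calc X ^ ((n + 1) * j * (c + 1)) * (X ^ ((n + 1) * (c + 1))) ^ n
        = (X ^ (n + 1)) ^ (c * (c + 1)) := by
          rw [← pow_mul, ← pow_mul, ← pow_add]; congr 1; rw [hcdef]; ring
      _ ≤ (cliqueSum H (n + 1) (fun x => ω₀ x * ψ x ^ j) * cliqueSum H (n + 1) ω ^ n) ^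
            (c * (c + 1)) := by gcongr
      _ = cliqueSum H (n + 1) (fun x => ω₀ x * ψ x ^ j) ^ (c * (c + 1)) *
            (cliqueSum H (n + 1) ω ^ n) ^ (c * (c + 1)) := mul_pow _ _ _
      _ ≤ (X ^ ((n + 1) * j * (c + 1)) * cliqueSum H (c + 1) ω₀ ^ (n * (n + 1))) *
            (cliqueSum H (n + 1) ω ^ n) ^ (c * (c + 1)) := by gcongr
      _ = _ := by
          rw [mul_pow, ← pow_mul, ← pow_mul, ← pow_mul, mul_assoc]
          congr 3 <;> ring
  have h3 := le_rpow_mul_rpow_of_pow_le (by positivity) hgoal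
  have hX' : ∑ s, ω₀ s * F s ^ ((c : ℝ) / n) = X :=
    Finset.sum_congr rfl fun s _ => by rw [hψc]
  refine hX'.le.trans ?_
  refine h3.trans (le_of_eq ?_)
  congr 2
  · push_cast; field_simp
  · push_cast; field_simp

end CliqueSum

/-! ### Weighted graph sums -/

section NonnegWeights

variable {Ω : Type w}

/-- The factor `H(x_u, x_v)` of the unordered pair `uv`, for nonnegative edge weights. -/
def edgeWeight (H : Ω → Ω → ℝ≥0) (hs : ∀ x y, H x y = H y x) {V : Type*} (x : V → Ω) (e : Sym2 V) : ℝ≥0 :=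
  Sym2.lift ⟨fun u v => H (x u) (x v), fun u v => hs (x u) (x v)⟩ e

/-- The edge weights of a model as nonnegative reals. -/
def nnEdge (M : SpinModel Ω) (x y : Ω) : ℝ≥0 := ⟨M.H x y, M.H_nonneg x y⟩

/-- The vertex weights of a model as nonnegative reals. -/
def nnWeight (M : SpinModel Ω) (x : Ω) : ℝ≥0 := ⟨M.weight x, M.weight_nonneg x⟩

theorem nnEdge_symm (M : SpinModel Ω) (x y : Ω) : M.nnEdge x y = M.nnEdge y x :=
  NNReal.eq (M.H_symm x y)

theorem coe_edgeWeight (M : SpinModel Ω) {V : Type*} (x : V → Ω) (e : Sym2 V) :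
    (edgeWeight M.nnEdge M.nnEdge_symm x e : ℝ) = M.edgeFactor x e := by
  induction e with | _ u v => rfl

end NonnegWeights

section GraphSum

variable {Ω : Type w} [Fintype Ω] {V : Type*} [Fintype V]

open scoped Classical in
theorem prod_edgeFinset_eq_mul {N : Type*} [CommMonoid N] (G : SimpleGraph V) (w : V)
    (f : Sym2 V → N) :
    ∏ e ∈ G.edgeFinset, f e =
      (∏ v ∈ G.neighborFinset w, f s(w, v)) *
        ∏ e ∈ (G.deleteIncidenceSet w).edgeFinset, f e := by
  rw [SimpleGraph.edgeFinset_deleteIncidenceSet_eq_filter, mul_comm,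
    ← Finset.prod_filter_not_mul_prod_filter G.edgeFinset (w ∈ ·)]
  congr 1
  symm
  refine Finset.prod_bij (fun v _ => s(w, v)) ?_ ?_ ?_ ?_
  · intro v hv
    simpa using hv
  · intro a _ b _ h
    exact Sym2.congr_right.1 h
  · intro e he
    obtain ⟨he1, he2⟩ := Finset.mem_filter.1 he
    obtain ⟨v, rfl⟩ := he2
    exact ⟨v, by simpa using he1, rfl⟩
  · intro v _; rfl

open scoped Classical in
/-- The partition function of `G` where each vertex carries its own vertex weights. -/
noncomputable def graphSum (H : Ω → Ω → ℝ≥0) (hs : ∀ x y, H x y = H y x) (G : SimpleGraph V)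
    (ω : V → Ω → ℝ≥0) : ℝ≥0 :=
  ∑ x : V → Ω, (∏ e ∈ G.edgeFinset, edgeWeight H hs x e) * ∏ v, ω v (x v)

open scoped Classical in
/-- The vertex weights obtained by giving the vertex `w` the spin `s`. -/
noncomputable def pinnedWeight (H : Ω → Ω → ℝ≥0) (G : SimpleGraph V) (ω : V → Ω → ℝ≥0) (w : V)
    (s : Ω) (v : V) (y : Ω) : ℝ≥0 :=
  (if v = w then (if y = s then 1 else 0) else 1) * ω v y * (if G.Adj w v then H s y else 1)

/-- The vertex `w` stays in the graph, isolated and with an indicator weight, so the vertex type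
does not change in the induction. -/
theorem graphSum_eq_sum (H : Ω → Ω → ℝ≥0) (hs : ∀ x y, H x y = H y x) (G : SimpleGraph V)
    (ω : V → Ω → ℝ≥0) (w : V) :
    graphSum H hs G ω =
      ∑ s, graphSum H hs (G.deleteIncidenceSet w) (pinnedWeight H G ω w s) := by
  classical
  unfold graphSum
  rw [Finset.sum_comm]
  refine Finset.sum_congr rfl fun x _ => ?_
  have h : ∀ s, ∏ v, pinnedWeight H G ω w s v (x v) =
      (if x w = s then 1 else 0) * (∏ v, ω v (x v)) * ∏ v ∈ G.neighborFinset w, H s (x v) := by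
    intro s
    simp only [pinnedWeight, Finset.prod_mul_distrib, Finset.prod_ite_eq', Finset.mem_univ, if_true]
    congr 1
    rw [← Finset.prod_filter]
    refine Finset.prod_congr ?_ fun _ _ => rfl
    ext v; simp
  simp_rw [h]
  rw [Finset.sum_eq_single (x w)]
  · rw [prod_edgeFinset_eq_mul G w]
    simp only [if_true, one_mul]
    have : ∏ v ∈ G.neighborFinset w, edgeWeight H hs x s(w, v) =
      ∏ v ∈ G.neighborFinset w, H (x w) (x v) := rfl
    rw [this]
    have : ∀ a b c d : ℝ≥0, b = d → a * b * c = d * (c * a) := by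
      intros a b c d h; rw [h]; ring
    apply this
    congr!
  · intro s _ hs
    simp [Ne.symm hs]
  · simp

-- Induction on the number of edges, pinning a vertex of maximal degree. The `c` neighbors each
-- contribute the `1 / c` power of the clique of `w`, which together give its factor.
open scoped Classical in
theorem graphSum_le (H : Ω → Ω → ℝ≥0) (hs : ∀ x y, H x y = H y x) (hP : CauchySchwarz H)
    (G : SimpleGraph V) (ω : V → Ω → ℝ≥0) :
    graphSum H hs G ω ≤
      ∏ v, cliqueSum H (G.degree v + 1) (ω v) ^ (1 / ((G.degree v : ℝ) + 1)) := by
  induction hm : G.edgeFinset.card using Nat.strong_induction_on generalizing G ω with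
  | _ m ih =>
  subst hm
  by_cases hE : ∀ v, G.degree v = 0
  · have hG : G = ⊥ := by
      ext u v
      simp only [SimpleGraph.bot_adj, iff_false]
      intro h
      have := (G.degree_pos_iff_exists_adj u).2 ⟨v, h⟩
      have := hE u
      omega
    have he : G.edgeFinset = ∅ := by
      refine Finset.eq_empty_of_forall_notMem fun e => ?_
      simp [hG]
    simp only [hE, graphSum]
    rw [he]
    simp [cliqueSum_one, Finset.prod_univ_sum]
  push Not at hE
  obtain ⟨u, hu⟩ := hE
  have : Nonempty V := ⟨u⟩
  -- Maximality gives the condition `n ≤ c` of `sum_mul_cliqueSum_rpow_le` at every neighbor.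
  obtain ⟨w, hw⟩ := Finite.exists_max fun v => G.degree v
  set c := G.degree w with hc
  have hc0 : 0 < c := lt_of_lt_of_le (Nat.pos_of_ne_zero hu) (hw u)
  have hc0' : (0 : ℝ) < c := by exact_mod_cast hc0
  obtain ⟨G', hG'⟩ : ∃ G', G' = G.deleteIncidenceSet w := ⟨_, rfl⟩
  have hlt : G'.edgeFinset.card < G.edgeFinset.card := by
    have h1 := G.card_edgeFinset_deleteIncidenceSet w
    have h2 := G.degree_le_card_edgeFinset (v := w)
    have h3 : G'.edgeFinset.card = (G.deleteIncidenceSet w).edgeFinset.card := by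
      subst hG'; congr!
    omega
  have hdw : G'.degree w = 0 := by
    rw [SimpleGraph.degree_eq_zero]
    intro v hv
    rw [hG'] at hv
    exact (SimpleGraph.deleteIncidenceSet_adj.1 hv).2.1 rfl
  have hdN : ∀ v, G.Adj w v → G'.degree v + 1 = G.degree v := by
    intro v hv
    have : G'.neighborFinset v = (G.neighborFinset v).erase w := by
      ext z
      simp only [SimpleGraph.mem_neighborFinset, Finset.mem_erase, hG',
        SimpleGraph.deleteIncidenceSet_adj]
      have := hv.ne'
      tauto
    rw [← SimpleGraph.card_neighborFinset_eq_degree, this, Finset.card_erase_add_one,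
      SimpleGraph.card_neighborFinset_eq_degree]
    simpa using hv.symm
  have hdO : ∀ v, v ≠ w → ¬ G.Adj w v → G'.degree v = G.degree v := by
    intro v hv hv'
    have : G'.neighborFinset v = G.neighborFinset v := by
      ext z
      simp only [SimpleGraph.mem_neighborFinset, hG', SimpleGraph.deleteIncidenceSet_adj]
      refine ⟨fun h => h.1, fun h => ⟨h, hv, ?_⟩⟩
      rintro rfl
      exact hv' h.symm
    rw [← SimpleGraph.card_neighborFinset_eq_degree, this,
      SimpleGraph.card_neighborFinset_eq_degree]
  have hsplit : ∀ f : V → ℝ≥0, ∏ v, f v = f w * ((∏ v ∈ G.neighborFinset w, f v) *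
      ∏ v ∈ (Finset.univ.erase w).filter (fun v => ¬ G.Adj w v), f v) := by
    intro f
    rw [← Finset.mul_prod_erase Finset.univ f (Finset.mem_univ w),
      ← Finset.prod_filter_mul_prod_filter_not (Finset.univ.erase w) (fun v => G.Adj w v)]
    congr 3
    ext v
    simp only [Finset.mem_filter, Finset.mem_erase, Finset.mem_univ, and_true,
      SimpleGraph.mem_neighborFinset, and_iff_right_iff_imp]
    exact fun h => h.ne'
  set R := ∏ v ∈ (Finset.univ.erase w).filter (fun v => ¬ G.Adj w v),
    cliqueSum H (G.degree v + 1) (ω v) ^ (1 / ((G.degree v : ℝ) + 1)) with hR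
  have hIH : ∀ s, graphSum H hs G' (pinnedWeight H G ω w s) ≤
      ω w s * ((∏ v ∈ G.neighborFinset w,
        cliqueSum H (G.degree v) (fun y => ω v y * H s y) ^ (1 / (G.degree v : ℝ))) * R) := by
    intro s
    refine (ih _ hlt G' _ rfl).trans (le_of_eq ?_)
    rw [hsplit]
    congr 1
    · rw [hdw, zero_add, cliqueSum_one]
      simp [pinnedWeight]
    congr 1
    · refine Finset.prod_congr rfl fun v hv => ?_
      rw [SimpleGraph.mem_neighborFinset] at hv
      have h1 := hdN v hv
      have h2 : (G'.degree v : ℝ) + 1 = G.degree v := by exact_mod_cast h1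
      rw [h1, h2]
      congr 2
      funext y
      simp [pinnedWeight, hv, hv.ne']
    · refine Finset.prod_congr rfl fun v hv => ?_
      simp only [Finset.mem_filter, Finset.mem_erase, Finset.mem_univ, and_true] at hv
      rw [hdO v hv.1 hv.2]
      congr 2
      funext y
      simp [pinnedWeight, hv.1, hv.2]
  have hcard : (G.neighborFinset w).card = c := G.card_neighborFinset_eq_degree w
  calc graphSum H hs G ω = ∑ s, graphSum H hs G' (pinnedWeight H G ω w s) := by
        rw [hG']; exact graphSum_eq_sum H hs G ω w
    _ ≤ ∑ s, ω w s * ((∏ v ∈ G.neighborFinset w,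
        cliqueSum H (G.degree v) (fun y => ω v y * H s y) ^ (1 / (G.degree v : ℝ))) * R) :=
        Finset.sum_le_sum fun s _ => hIH s
    _ = (∑ s, ω w s * ∏ v ∈ G.neighborFinset w,
        (cliqueSum H (G.degree v) (fun y => ω v y * H s y) ^ ((c : ℝ) / G.degree v)) ^
          (1 / (c : ℝ))) * R := by
        rw [Finset.sum_mul]
        refine Finset.sum_congr rfl fun s _ => ?_
        rw [mul_assoc]
        congr 2
        refine Finset.prod_congr rfl fun v _ => ?_
        rw [← NNReal.rpow_mul]
        congr 1
        field_simp
    _ ≤ (∏ v ∈ G.neighborFinset w, (∑ s, ω w s *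
        cliqueSum H (G.degree v) (fun y => ω v y * H s y) ^ ((c : ℝ) / G.degree v)) ^
          (1 / (c : ℝ))) * R := by
        gcongr
        refine sum_mul_prod_rpow_le _ _ _ _ _ (fun _ _ => by positivity) ?_
        rw [Finset.sum_const, hcard, nsmul_eq_mul, mul_one_div_cancel hc0'.ne']
    _ ≤ (∏ v ∈ G.neighborFinset w, (cliqueSum H (c + 1) (ω w) ^ (1 / ((c : ℝ) + 1)) *
        cliqueSum H (G.degree v + 1) (ω v) ^ ((c : ℝ) / ((G.degree v : ℝ) + 1))) ^
          (1 / (c : ℝ))) * R := by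
        refine mul_le_mul_left (Finset.prod_le_prod' fun v hv => ?_) _
        rw [SimpleGraph.mem_neighborFinset] at hv
        refine NNReal.rpow_le_rpow ?_ (by positivity)
        refine sum_mul_cliqueSum_rpow_le H hs hP ?_ (hw v) (ω w) (ω v)
        exact (G.degree_pos_iff_exists_adj v).2 ⟨w, hv.symm⟩
    _ = _ := by
        rw [hsplit, ← mul_assoc]
        congr 1
        simp_rw [NNReal.mul_rpow]
        rw [Finset.prod_mul_distrib, Finset.prod_const, hcard]
        congr 1
        · rw [← NNReal.rpow_natCast, ← NNReal.rpow_mul, ← NNReal.rpow_mul]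
          congr 1
          field_simp
          rw [hc]
        · refine Finset.prod_congr rfl fun v _ => ?_
          rw [← NNReal.rpow_mul]
          congr 1
          field_simp

end GraphSum

/-! ### Complete graphs and the ferromagnetic bound. -/

section Clique

variable {Ω : Type w} [Fintype Ω]

theorem prod_edgeFinset_top {N : Type*} [CommMonoid N] (n : ℕ) (f : Sym2 (Fin n) → N)
    [Fintype (⊤ : SimpleGraph (Fin n)).edgeSet] :
    ∏ e ∈ (⊤ : SimpleGraph (Fin n)).edgeFinset, f e =
      ∏ i, ∏ j, if i < j then f s(i, j) else 1 := by
  classical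
  rw [← Finset.prod_product', ← Finset.prod_filter]
  symm
  refine Finset.prod_bij (fun p _ => s(p.1, p.2)) ?_ ?_ ?_ ?_
  · rintro ⟨i, j⟩ h
    simp only [Finset.mem_filter, Finset.mem_product, Finset.mem_univ, true_and] at h
    simpa using h.ne
  · rintro ⟨i, j⟩ h ⟨k, l⟩ h' he
    simp only [Finset.mem_filter, Finset.mem_product, Finset.mem_univ, true_and] at h h'
    rw [Sym2.eq_iff] at he
    rcases he with ⟨h1, h2⟩ | ⟨h1, h2⟩
    · exact Prod.ext h1 h2
    · simp only at h1 h2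
      subst h1 h2
      exact absurd h (lt_asymm h')
  · intro e he
    induction e with | _ i j =>
    have hne : i ≠ j := by simpa using he
    rcases lt_or_gt_of_ne hne with h | h
    · exact ⟨(i, j), by simpa using h, rfl⟩
    · exact ⟨(j, i), by simpa using h, Sym2.eq_swap⟩
  · intro p _; rfl

theorem graphSum_top (H : Ω → Ω → ℝ≥0) (hs : ∀ x y, H x y = H y x) (n : ℕ) (ω : Ω → ℝ≥0) :
    graphSum H hs (⊤ : SimpleGraph (Fin n)) (fun _ => ω) = cliqueSum H n ω := by
  classical
  have h : ∀ n (ω : Ω → ℝ≥0), ∑ x : Fin n → Ω,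
      (∏ i, ∏ j, if i < j then H (x i) (x j) else 1) * ∏ i, ω (x i) = cliqueSum H n ω := by
    intro n
    induction n with
    | zero => intro ω; simp [cliqueSum]
    | succ n ih =>
      intro ω
      rw [cliqueSum, ← (Fin.consEquiv fun _ : Fin (n + 1) => Ω).sum_comp, Fintype.sum_prod_type]
      refine Finset.sum_congr rfl fun s _ => ?_
      rw [← ih, Finset.mul_sum]
      refine Finset.sum_congr rfl fun x _ => ?_
      simp only [Fin.consEquiv, Equiv.coe_fn_mk, Fin.prod_univ_succ, Fin.cons_zero, Fin.cons_succ,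
        Fin.succ_lt_succ_iff, Fin.succ_pos, if_true, if_false, Fin.not_lt_zero, one_mul,
        Finset.prod_mul_distrib]
      ring
  rw [← h]
  unfold graphSum
  refine Finset.sum_congr (by congr!) fun x _ => ?_
  rw [prod_edgeFinset_top]
  rfl

theorem coe_graphSum (M : SpinModel Ω) {V : Type*} [Fintype V] (G : SimpleGraph V) :
    (graphSum M.nnEdge M.nnEdge_symm G (fun _ => M.nnWeight) : ℝ) = M.hom G := by
  unfold graphSum hom
  push_cast
  simp_rw [coe_edgeWeight]
  rfl

theorem coe_cliqueSum (M : SpinModel Ω) (n : ℕ) :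
    (cliqueSum M.nnEdge n M.nnWeight : ℝ) = M.homClique n := by
  rw [homClique, ← coe_graphSum, graphSum_top]

/-- The quadratic form at `t a + b` is nonnegative for all real `t`, so its discriminant is
nonpositive. -/
theorem cauchySchwarz_nnEdge (M : SpinModel Ω) (h : M.IsFerromagnetic) :
    CauchySchwarz M.nnEdge := by
  intro a b
  rw [← NNReal.coe_le_coe]
  push_cast
  have hq : ∀ c : Ω → ℝ, 0 ≤ ∑ x, ∑ y, c x * c y * M.H x y := by
    intro c
    have := h.dotProduct_mulVec_nonneg c
    refine this.trans (le_of_eq ?_)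
    simp [dotProduct, Matrix.mulVec, Finset.mul_sum]
    exact Finset.sum_congr rfl fun x _ => Finset.sum_congr rfl fun y _ => by ring
  set A := ∑ x, ∑ y, (a x : ℝ) * a y * M.nnEdge x y
  set B := ∑ x, ∑ y, (a x : ℝ) * b y * M.nnEdge x y with hB
  set C := ∑ x, ∑ y, (b x : ℝ) * b y * M.nnEdge x y
  have hB' : B = ∑ x, ∑ y, (b x : ℝ) * a y * M.nnEdge x y := by
    rw [hB, Finset.sum_comm]
    refine Finset.sum_congr rfl fun x _ => Finset.sum_congr rfl fun y _ => ?_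
    rw [M.nnEdge_symm y x]; ring
  have hd : discrim A (2 * B) C ≤ 0 := by
    refine discrim_le_zero fun t => ?_
    have h1 := hq fun x => t * a x + b x
    have h2 : ∑ x, ∑ y, (t * (a x : ℝ) + b x) * (t * a y + b y) * M.H x y =
        t * t * A + t * B + t * (∑ x, ∑ y, (b x : ℝ) * a y * M.nnEdge x y) + C := by
      simp only [A, B, C, Finset.mul_sum, ← Finset.sum_add_distrib]
      refine Finset.sum_congr rfl fun x _ => Finset.sum_congr rfl fun y _ => ?_
      change _ = t * t * (_ * _ * M.H x y) + t * (_ * _ * M.H x y) + t * (_ * _ * M.H x y) +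
        _ * _ * M.H x y
      ring
    rw [h2, ← hB'] at h1
    linarith
  unfold discrim at hd
  nlinarith

theorem IsFerromagnetic.isCliqueMaximizing (M : SpinModel Ω) (h : M.IsFerromagnetic) :
    IsCliqueMaximizing.{u} M := by
  intro V _ G
  have := NNReal.coe_le_coe.2 (graphSum_le M.nnEdge M.nnEdge_symm (M.cauchySchwarz_nnEdge h) G
    (fun _ => M.nnWeight))
  rw [coe_graphSum] at this
  push_cast at this
  simp_rw [coe_cliqueSum] at this
  exact this

end Clique

/-! ### Weighted biclique sums and bipartite graphs -/

section Biclique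

variable {Ω : Type w} [Fintype Ω]

/-- The partition function of the complete bipartite graph with `p` vertices of weights `α` on one
side and `q` vertices of weights `β` on the other side. -/
noncomputable def bicliqueSum (H : Ω → Ω → ℝ≥0) (p q : ℕ) (α β : Ω → ℝ≥0) : ℝ≥0 :=
  ∑ x : Fin p → Ω, (∏ i, α (x i)) * (∑ y, β y * ∏ i, H (x i) y) ^ q

theorem bicliqueSum_eq_sum (H : Ω → Ω → ℝ≥0) (p q : ℕ) (α β : Ω → ℝ≥0) :
    bicliqueSum H p q α β = ∑ x : Fin p → Ω, ∑ y : Fin q → Ω,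
      (∏ i, α (x i)) * (∏ j, β (y j)) * ∏ j, ∏ i, H (x i) (y j) := by
  unfold bicliqueSum
  refine Finset.sum_congr rfl fun x _ => ?_
  rw [Fintype.sum_pow, Finset.mul_sum]
  refine Finset.sum_congr rfl fun y _ => ?_
  rw [Finset.prod_mul_distrib, mul_assoc]

theorem bicliqueSum_comm (H : Ω → Ω → ℝ≥0) (hs : ∀ x y, H x y = H y x) (p q : ℕ)
    (α β : Ω → ℝ≥0) : bicliqueSum H p q α β = bicliqueSum H q p β α := by
  rw [bicliqueSum_eq_sum, bicliqueSum_eq_sum, Finset.sum_comm]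
  refine Finset.sum_congr rfl fun x _ => Finset.sum_congr rfl fun y _ => ?_
  rw [Finset.prod_comm, mul_comm (∏ i, α (y i))]
  congr 1
  exact Finset.prod_congr rfl fun i _ => Finset.prod_congr rfl fun j _ => hs _ _

theorem bicliqueSum_one (H : Ω → Ω → ℝ≥0) (q : ℕ) (α β : Ω → ℝ≥0) :
    bicliqueSum H 1 q α β = ∑ x, α x * (∑ y, β y * H x y) ^ q := by
  unfold bicliqueSum
  rw [← (Equiv.funUnique (Fin 1) Ω).symm.sum_comp]
  simp

/-- The one-neighbor inequality for bicliques. The left side is a biclique with one exceptional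
vertex of weight `α φ`; two applications of Hölder bound it by the two bicliques and a power of
itself, which cancels. -/
theorem sum_mul_bicliqueSum_rpow_le (H : Ω → Ω → ℝ≥0) (hs : ∀ x y, H x y = H y x)
    {l c : ℕ} (hl : 0 < l) (hc : l ≤ c) (m : ℕ) (α β γ : Ω → ℝ≥0) :
    ∑ s, α s * bicliqueSum H l m (fun y => β y * H s y) γ ^ ((c : ℝ) / l) ≤
      bicliqueSum H (m + 1) c α β ^ (1 / ((m : ℝ) + 1)) *
        bicliqueSum H l (m + 1) β γ ^ ((m : ℝ) * c / (l * ((m : ℝ) + 1))) := by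
  have hl' : (0 : ℝ) < l := by exact_mod_cast hl
  have hc' : (0 : ℝ) < c := by exact_mod_cast hl.trans_le hc
  have hlc : (l : ℝ) ≤ c := by exact_mod_cast hc
  set F : Ω → ℝ≥0 := fun s => bicliqueSum H l m (fun y => β y * H s y) γ with hF
  set X := ∑ s, α s * F s ^ ((c : ℝ) / l) with hX
  change X ≤ _
  rcases eq_or_ne X 0 with h0 | h0
  · rw [h0]; exact zero_le
  let φ : Ω → ℝ≥0 := fun s => F s ^ (((c : ℝ) - l) / l)
  have hφ : ∀ s, φ s * F s = F s ^ ((c : ℝ) / l) := by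
    intro s
    rcases eq_or_ne (F s) 0 with h | h
    · rw [h, mul_zero, NNReal.zero_rpow (by positivity)]
    · rw [show (c : ℝ) / l = ((c : ℝ) - l) / l + 1 by field_simp; ring,
        NNReal.rpow_add h, NNReal.rpow_one]
  let f : (Fin l → Ω) → ℝ≥0 := fun y => ∑ s, α s * φ s * ∏ i, H (y i) s
  let g : (Fin l → Ω) → ℝ≥0 := fun y => ∑ z, γ z * ∏ i, H (y i) z
  have hX1 : X = ∑ y : Fin l → Ω, (∏ i, β (y i)) * (f y * g y ^ m) := by
    calc X = ∑ s, α s * φ s * F s := by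
          refine Finset.sum_congr rfl fun s _ => ?_
          rw [mul_assoc, hφ]
      _ = ∑ s, ∑ y : Fin l → Ω, α s * φ s * ((∏ i, β (y i) * H s (y i)) * g y ^ m) := by
          refine Finset.sum_congr rfl fun s _ => ?_
          simp only [hF, bicliqueSum, Finset.mul_sum]
          rfl
      _ = _ := by
          rw [Finset.sum_comm]
          refine Finset.sum_congr rfl fun y _ => ?_
          simp only [f, Finset.sum_mul, Finset.mul_sum]
          refine Finset.sum_congr rfl fun s _ => ?_
          rw [Finset.prod_mul_distrib]
          simp_rw [hs s]
          ring
  have hX2 : X ^ (m + 1) ≤ bicliqueSum H l (m + 1) β (fun s => α s * φ s) *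
      bicliqueSum H l (m + 1) β γ ^ m := by
    rw [hX1]
    refine sum_mul_pow_le Finset.univ _ _ (fun y => f y ^ (m + 1)) (fun y => g y ^ (m + 1)) m
      fun y _ => le_of_eq ?_
    rw [mul_pow, ← pow_mul, ← pow_mul, mul_comm m]
  -- Hölder over the spins of the `m + 1` vertices of weight `α φ` turns the `l` vertices on the
  -- other side into `c`; the powers of `F` sum to `X ^ (m + 1)`.
  have hX3 : bicliqueSum H l (m + 1) β (fun s => α s * φ s) ≤
      (X ^ (m + 1)) ^ (((c : ℝ) - l) / c) * bicliqueSum H (m + 1) c α β ^ ((l : ℝ) / c) := by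
    rw [bicliqueSum_comm H hs]
    have h := sum_mul_rpow_mul_rpow_le (Finset.univ : Finset (Fin (m + 1) → Ω))
      (fun s => ∏ j, α (s j)) (fun s => ∏ j, F (s j) ^ ((c : ℝ) / l))
      (fun s => (∑ y, β y * ∏ j, H (s j) y) ^ c)
      (a := ((c : ℝ) - l) / c) (b := (l : ℝ) / c)
      (div_nonneg (sub_nonneg.2 hlc) hc'.le) (by positivity) (by field_simp; ring)
    refine (le_of_eq ?_).trans (h.trans (le_of_eq ?_))
    · refine Finset.sum_congr rfl fun s _ => ?_
      rw [Finset.prod_mul_distrib, mul_assoc, ← NNReal.finsetProd_rpow]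
      congr 2
      · refine Finset.prod_congr rfl fun j _ => ?_
        rw [← NNReal.rpow_mul]
        simp only [φ]
        congr 1
        field_simp
      · rw [← NNReal.rpow_natCast _ c, ← NNReal.rpow_mul, mul_div_cancel₀ _ hc'.ne',
          NNReal.rpow_natCast]
    · congr 2
      rw [hX, Fintype.sum_pow]
      refine Finset.sum_congr rfl fun s _ => ?_
      rw [Finset.prod_mul_distrib]
  set A := bicliqueSum H (m + 1) c α β
  set B := bicliqueSum H l (m + 1) β γ
  have h4 : (X ^ (m + 1)) ^ ((l : ℝ) / c) ≤ A ^ ((l : ℝ) / c) * B ^ m := by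
    have hY : X ^ (m + 1) ≠ 0 := pow_ne_zero _ h0
    refine le_of_mul_le_mul_left ?_
      (pos_iff_ne_zero.2 (NNReal.rpow_pos (p := ((c : ℝ) - l) / c) (pos_iff_ne_zero.2 hY)).ne')
    calc (X ^ (m + 1)) ^ (((c : ℝ) - l) / c) * (X ^ (m + 1)) ^ ((l : ℝ) / c) = X ^ (m + 1) := by
          rw [← NNReal.rpow_add hY, ← add_div, sub_add_cancel, div_self hc'.ne', NNReal.rpow_one]
      _ ≤ _ := hX2
      _ ≤ _ := mul_le_mul_left hX3 _
      _ = _ := by ring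
  have h5 := NNReal.rpow_le_rpow h4
    (by positivity : (0 : ℝ) ≤ (c : ℝ) / (l * ((m : ℝ) + 1)))
  have hm : (0 : ℝ) < (m : ℝ) + 1 := by positivity
  rw [NNReal.mul_rpow, ← NNReal.rpow_natCast, ← NNReal.rpow_natCast, ← NNReal.rpow_mul,
    ← NNReal.rpow_mul, ← NNReal.rpow_mul, ← NNReal.rpow_mul] at h5
  refine le_trans (le_of_eq ?_) (h5.trans (le_of_eq ?_))
  · conv_lhs => rw [← NNReal.rpow_one X]
    congr 1
    push_cast
    field_simp
  · congr 2
    · field_simp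
    · field_simp

open scoped Classical in
/-- The partition function of the bipartite graph with edge relation `E`. -/
noncomputable def bipartiteSum {A B : Type*} [Fintype A] [Fintype B] (H : Ω → Ω → ℝ≥0)
    (E : A → B → Prop) (α : A → Ω → ℝ≥0) (β : B → Ω → ℝ≥0) : ℝ≥0 :=
  ∑ x : A → Ω, ∑ y : B → Ω, (∏ b, ∏ a with E a b, H (x a) (y b)) *
    ((∏ a, α a (x a)) * ∏ b, β b (y b))

open scoped Classical in
/-- The number of neighbors of `a`. -/
noncomputable def rightDegree {A B : Type*} [Fintype B] (E : A → B → Prop) (a : A) : ℕ :=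
  (Finset.univ.filter fun b => E a b).card

open scoped Classical in
/-- The neighbors of `b`. -/
noncomputable def leftNeighbors {A B : Type*} [Fintype A] (E : A → B → Prop) (b : B) : Finset A :=
  Finset.univ.filter fun a => E a b

/-- The factor of the upper bound for the bipartite partition function contributed by `b` and the
edges at `b`. -/
noncomputable def rightFactor {A B : Type*} [Fintype A] [Fintype B] (H : Ω → Ω → ℝ≥0)
    (E : A → B → Prop) (α : A → Ω → ℝ≥0) (β : B → Ω → ℝ≥0) (b : B) : ℝ≥0 :=
  (if (leftNeighbors E b).card = 0 then ∑ y, β b y else 1) *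
    ∏ a ∈ leftNeighbors E b, bicliqueSum H (leftNeighbors E b).card (rightDegree E a)
      (α a) (β b) ^ (1 / (((leftNeighbors E b).card : ℝ) * rightDegree E a))

variable {A B : Type*} [Fintype A] [Fintype B]

open scoped Classical in
theorem bipartiteSum_eq_sum (H : Ω → Ω → ℝ≥0)
    (E : A → B → Prop) (α : A → Ω → ℝ≥0) (β : B → Ω → ℝ≥0) (w : A) :
    bipartiteSum H E α β = ∑ s, bipartiteSum H (fun a b => E a b ∧ a ≠ w)
      (fun a y => (if a = w then (if y = s then 1 else 0) else 1) * α a y)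
      (fun b y => β b y * if E w b then H s y else 1) := by
  unfold bipartiteSum
  refine Eq.trans (Finset.sum_congr rfl fun x _ => ?_) Finset.sum_comm
  refine Eq.trans (Finset.sum_congr rfl fun y _ => ?_) Finset.sum_comm
  have h1 : ∀ s, ∏ a, (if a = w then (if x a = s then (1 : ℝ≥0) else 0) else 1) * α a (x a) =
      (if x w = s then 1 else 0) * ∏ a, α a (x a) := by
    intro s
    rw [Finset.prod_mul_distrib, Finset.prod_ite_eq' Finset.univ w]
    simp
  have h2 : ∀ b, ∏ a with E a b, H (x a) (y b) = (if E w b then H (x w) (y b) else 1) *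
      ∏ a with E a b ∧ a ≠ w, H (x a) (y b) := by
    intro b
    simp_rw [Finset.prod_filter]
    rw [← Finset.mul_prod_erase _ _ (Finset.mem_univ w),
      ← Finset.mul_prod_erase Finset.univ (fun a => if E a b ∧ a ≠ w then _ else _)
        (Finset.mem_univ w)]
    simp only [ne_eq, not_true, and_false, if_false, one_mul]
    congr 1
    refine Finset.prod_congr rfl fun a ha => ?_
    simp [(Finset.mem_erase.1 ha).1]
  rw [Finset.sum_eq_single (x w)]
  · simp_rw [h1, h2, Finset.prod_mul_distrib]
    simp only [if_true, one_mul]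
    ring
  · intro s _ hs
    rw [h1]
    simp [Ne.symm hs]
  · simp

end Biclique

/-! ### The biclique bound for bipartite graphs. -/

section Bipartite

variable {A B : Type*}

theorem mem_leftNeighbors [Fintype A] {E : A → B → Prop} {a : A} {b : B} :
    a ∈ leftNeighbors E b ↔ E a b := by
  simp [leftNeighbors]

open scoped Classical in
theorem leftNeighbors_delete [Fintype A] (E : A → B → Prop) (w : A) (b : B) :
    leftNeighbors (fun a b => E a b ∧ a ≠ w) b = (leftNeighbors E b).erase w := by
  ext a
  simp [mem_leftNeighbors, and_comm]

theorem rightDegree_delete [Fintype B] (E : A → B → Prop) {w a : A} (h : a ≠ w) :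
    rightDegree (fun a b => E a b ∧ a ≠ w) a = rightDegree E a := by
  unfold rightDegree
  congr 1
  ext b
  simp [h]

theorem rightDegree_delete_self [Fintype B] (E : A → B → Prop) (w : A) :
    rightDegree (fun a b => E a b ∧ a ≠ w) w = 0 := by
  simp [rightDegree]

theorem rightDegree_pos [Fintype B] {E : A → B → Prop} {a : A} {b : B} (h : E a b) :
    0 < rightDegree E a :=
  Finset.card_pos.2 ⟨b, by simpa using h⟩

variable [Fintype A] [Fintype B] {Ω : Type w} [Fintype Ω]

open scoped Classical in
theorem rightFactor_delete_of_not (H : Ω → Ω → ℝ≥0) (E : A → B → Prop) (α : A → Ω → ℝ≥0)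
    (β : B → Ω → ℝ≥0) {w : A} {b : B} (hb : ¬ E w b) (s : Ω) :
    rightFactor H (fun a b => E a b ∧ a ≠ w)
      (fun a y => (if a = w then (if y = s then 1 else 0) else 1) * α a y)
      (fun b y => β b y * if E w b then H s y else 1) b = rightFactor H E α β b := by
  unfold rightFactor
  have hf : leftNeighbors (fun a b => E a b ∧ a ≠ w) b = leftNeighbors E b := by
    rw [leftNeighbors_delete, Finset.erase_eq_of_notMem]
    simpa [mem_leftNeighbors] using hb
  rw [hf]
  simp only [hb, if_false, mul_one]
  congr 1
  refine Finset.prod_congr rfl fun a ha => ?_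
  have haw : a ≠ w := by
    rintro rfl
    exact hb (mem_leftNeighbors.1 ha)
  rw [rightDegree_delete E haw]
  simp [haw]

-- Deleting `w` lowers the degree of `b` by one and leaves the degrees of its other neighbors
-- unchanged. Hölder over those `m` neighbors reduces to `sum_mul_bicliqueSum_rpow_le`.
open scoped Classical in
theorem sum_mul_rightFactor_pow_le (H : Ω → Ω → ℝ≥0) (hs : ∀ x y, H x y = H y x)
    (E : A → B → Prop) (α : A → Ω → ℝ≥0) (β : B → Ω → ℝ≥0) {w : A}
    (hw : ∀ a, rightDegree E a ≤ rightDegree E w) {b : B} (hb : E w b) :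
    ∑ s, α w s * rightFactor H (fun a b => E a b ∧ a ≠ w)
      (fun a y => (if a = w then (if y = s then 1 else 0) else 1) * α a y)
      (fun b y => β b y * if E w b then H s y else 1) b ^ rightDegree E w ≤
      rightFactor H E α β b ^ rightDegree E w := by
  set c := rightDegree E w with hc
  have hc0 : 0 < c := rightDegree_pos hb
  have hc' : (0 : ℝ) < c := by exact_mod_cast hc0
  obtain ⟨S, hS⟩ : ∃ S, S = (leftNeighbors E b).erase w := ⟨_, rfl⟩
  have hwS : w ∈ leftNeighbors E b := mem_leftNeighbors.2 hb
  have hcard : (leftNeighbors E b).card = S.card + 1 := by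
    rw [hS, Finset.card_erase_add_one hwS]
  obtain ⟨m, hm⟩ : ∃ m, m = S.card := ⟨_, rfl⟩
  have hSmem : ∀ a ∈ S, a ≠ w ∧ E a b := fun a ha => by
    rw [hS] at ha
    simpa [mem_leftNeighbors] using ha
  set T : A → ℝ≥0 := fun a => bicliqueSum H (m + 1) (rightDegree E a) (α a) (β b) with hT
  have hR : rightFactor H E α β b ^ c = T w ^ (1 / ((m : ℝ) + 1)) *
      ∏ a ∈ S, T a ^ ((c : ℝ) / (((m : ℝ) + 1) * rightDegree E a)) := by
    unfold rightFactor
    rw [hcard, ← hm, if_neg (by omega), one_mul, ← Finset.mul_prod_erase _ _ hwS, ← hS, mul_pow,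
      ← Finset.prod_pow]
    congr 1
    · rw [← NNReal.rpow_natCast, ← NNReal.rpow_mul]
      congr 1
      push_cast
      rw [← hc]
      field_simp
    · refine Finset.prod_congr rfl fun a ha => ?_
      have := rightDegree_pos (hSmem a ha).2
      rw [← NNReal.rpow_natCast, ← NNReal.rpow_mul]
      congr 1
      push_cast
      field_simp
  have hL : ∀ s, rightFactor H (fun a b => E a b ∧ a ≠ w)
      (fun a y => (if a = w then (if y = s then 1 else 0) else 1) * α a y)
      (fun b y => β b y * if E w b then H s y else 1) b =
      (if m = 0 then ∑ y, β b y * H s y else 1) *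
        ∏ a ∈ S, bicliqueSum H m (rightDegree E a) (α a) (fun y => β b y * H s y) ^
          (1 / ((m : ℝ) * rightDegree E a)) := by
    intro s
    unfold rightFactor
    rw [leftNeighbors_delete, ← hS, ← hm]
    simp only [hb, if_true]
    congr 1
    refine Finset.prod_congr rfl fun a ha => ?_
    rw [rightDegree_delete E (hSmem a ha).1]
    simp [(hSmem a ha).1]
  simp_rw [hL]
  rw [hR]
  -- If `w` was the only neighbor, `b` becomes isolated and its factor is the sum of its pinned
  -- weights; both sides then agree.
  rcases Nat.eq_zero_or_pos m with h0 | h0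
  · have hSe : S = ∅ := Finset.card_eq_zero.1 (by omega)
    subst hSe
    simp [h0, hT, bicliqueSum_one, ← hc]
  · have hm' : (0 : ℝ) < m := by exact_mod_cast h0
    simp only [if_neg h0.ne', one_mul]
    calc ∑ s, α w s * (∏ a ∈ S, bicliqueSum H m (rightDegree E a) (α a)
          (fun y => β b y * H s y) ^ (1 / ((m : ℝ) * rightDegree E a))) ^ c
        = ∑ s, α w s * ∏ a ∈ S, (bicliqueSum H (rightDegree E a) m (fun y => β b y * H s y)
          (α a) ^ ((c : ℝ) / rightDegree E a)) ^ (1 / (m : ℝ)) := by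
          refine Finset.sum_congr rfl fun s _ => ?_
          rw [← Finset.prod_pow]
          congr 1
          refine Finset.prod_congr rfl fun a ha => ?_
          rw [bicliqueSum_comm H hs, ← NNReal.rpow_natCast, ← NNReal.rpow_mul, ← NNReal.rpow_mul]
          congr 1
          have := rightDegree_pos (hSmem a ha).2
          field_simp
      _ ≤ ∏ a ∈ S, (∑ s, α w s * bicliqueSum H (rightDegree E a) m (fun y => β b y * H s y)
          (α a) ^ ((c : ℝ) / rightDegree E a)) ^ (1 / (m : ℝ)) := by
          refine sum_mul_prod_rpow_le _ _ _ _ _ (fun _ _ => by positivity) ?_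
          rw [Finset.sum_const, ← hm, nsmul_eq_mul, mul_one_div_cancel hm'.ne']
      _ ≤ ∏ a ∈ S, (T w ^ (1 / ((m : ℝ) + 1)) *
          T a ^ ((m : ℝ) * c / (rightDegree E a * ((m : ℝ) + 1)))) ^ (1 / (m : ℝ)) := by
          refine Finset.prod_le_prod' fun a ha => NNReal.rpow_le_rpow ?_ (by positivity)
          refine (sum_mul_bicliqueSum_rpow_le H hs (rightDegree_pos (hSmem a ha).2) (hw a) m _ _
            _).trans (le_of_eq ?_)
          rw [bicliqueSum_comm H hs (rightDegree E a)]
      _ = _ := by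
          simp_rw [NNReal.mul_rpow]
          rw [Finset.prod_mul_distrib, Finset.prod_const, ← hm]
          congr 1
          · rw [← NNReal.rpow_natCast, ← NNReal.rpow_mul, ← NNReal.rpow_mul]
            congr 1
            field_simp
          · refine Finset.prod_congr rfl fun a ha => ?_
            have := rightDegree_pos (hSmem a ha).2
            rw [← NNReal.rpow_mul]
            congr 1
            field_simp

-- Induction on the number of edges, pinning a vertex of maximal degree on the left side. Isolated
-- vertices arise on both sides and need their own factors.
open scoped Classical in
theorem bipartiteSum_le (H : Ω → Ω → ℝ≥0) (hs : ∀ x y, H x y = H y x)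
    (E : A → B → Prop) (α : A → Ω → ℝ≥0) (β : B → Ω → ℝ≥0) :
    bipartiteSum H E α β ≤
      (∏ a, if rightDegree E a = 0 then ∑ x, α a x else 1) * ∏ b, rightFactor H E α β b := by
  induction hm : ∑ a, rightDegree E a using Nat.strong_induction_on generalizing E α β with
  | _ m ih =>
  subst hm
  by_cases hE : ∀ a, rightDegree E a = 0
  · have hE' : ∀ a b, ¬ E a b := fun a b h => (rightDegree_pos h).ne' (hE a)
    simp only [hE, if_true]
    unfold bipartiteSum rightFactor leftNeighbors
    simp only [hE', Finset.filter_false, Finset.prod_empty, Finset.prod_const_one, one_mul,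
      Finset.card_empty, if_true, mul_one]
    rw [Finset.prod_univ_sum, Finset.prod_univ_sum, Finset.sum_mul]
    simp only [Fintype.piFinset_univ, Finset.mul_sum]
    exact le_of_eq (by congr!)
  push Not at hE
  obtain ⟨u, hu⟩ := hE
  have : Nonempty A := ⟨u⟩
  obtain ⟨w, hw⟩ := Finite.exists_max fun a => rightDegree E a
  have hc0 : 0 < rightDegree E w := (Nat.pos_of_ne_zero hu).trans_le (hw u)
  have hc' : (0 : ℝ) < rightDegree E w := by exact_mod_cast hc0
  have hlt : ∑ a, rightDegree (fun a b => E a b ∧ a ≠ w) a < ∑ a, rightDegree E a := by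
    refine Finset.sum_lt_sum (fun a _ => ?_) ⟨w, Finset.mem_univ w, ?_⟩
    · rcases eq_or_ne a w with rfl | h
      · rw [rightDegree_delete_self]; exact Nat.zero_le _
      · rw [rightDegree_delete E h]
    · rw [rightDegree_delete_self]; exact hc0
  set L := ∏ a, if rightDegree E a = 0 then ∑ x, α a x else 1 with hL
  set N := Finset.univ.filter fun b => E w b with hN
  set R := ∏ b with ¬ E w b, rightFactor H E α β b with hR
  set W : Ω → B → ℝ≥0 := fun s b => rightFactor H (fun a b => E a b ∧ a ≠ w)
      (fun a y => (if a = w then (if y = s then 1 else 0) else 1) * α a y)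
      (fun b y => β b y * if E w b then H s y else 1) b with hW
  have hIH : ∀ s, bipartiteSum H (fun a b => E a b ∧ a ≠ w)
      (fun a y => (if a = w then (if y = s then 1 else 0) else 1) * α a y)
      (fun b y => β b y * if E w b then H s y else 1) ≤
      α w s * (∏ b ∈ N, W s b) * (L * R) := by
    intro s
    refine (ih _ hlt _ _ _ rfl).trans (le_of_eq ?_)
    have h1 : (∏ a, if rightDegree (fun a b => E a b ∧ a ≠ w) a = 0 then
        ∑ x, (if a = w then (if x = s then (1 : ℝ≥0) else 0) else 1) * α a x else 1) =
        α w s * L := by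
      rw [hL, ← Finset.mul_prod_erase _ _ (Finset.mem_univ w),
        ← Finset.mul_prod_erase Finset.univ (fun a => if rightDegree E a = 0 then _ else _)
          (Finset.mem_univ w), if_neg hc0.ne', one_mul, if_pos (rightDegree_delete_self E w)]
      congr 1
      · simp
      · refine Finset.prod_congr rfl fun a ha => ?_
        have haw := (Finset.mem_erase.1 ha).1
        rw [rightDegree_delete E haw]
        simp [haw]
    have h2 : ∏ b, W s b = (∏ b ∈ N, W s b) * R := by
      rw [← Finset.prod_filter_mul_prod_filter_not Finset.univ (fun b => E w b)]
      congr 1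
      refine Finset.prod_congr rfl fun b hb => ?_
      exact rightFactor_delete_of_not H E α β (by simpa using hb) s
    change _ * ∏ b, W s b = _
    rw [h1, h2]
    ring
  calc bipartiteSum H E α β = _ := bipartiteSum_eq_sum H E α β w
    _ ≤ ∑ s, α w s * (∏ b ∈ N, W s b) * (L * R) := Finset.sum_le_sum fun s _ => hIH s
    _ = (∑ s, α w s * ∏ b ∈ N, (W s b ^ rightDegree E w) ^ (1 / (rightDegree E w : ℝ))) *
        (L * R) := by
        rw [Finset.sum_mul]
        refine Finset.sum_congr rfl fun s _ => ?_
        congr 2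
        refine Finset.prod_congr rfl fun b _ => ?_
        rw [← NNReal.rpow_natCast, ← NNReal.rpow_mul, mul_one_div_cancel hc'.ne', NNReal.rpow_one]
    _ ≤ (∏ b ∈ N, (∑ s, α w s * W s b ^ rightDegree E w) ^ (1 / (rightDegree E w : ℝ))) *
        (L * R) := by
        refine mul_le_mul_left (sum_mul_prod_rpow_le _ _ _ _ _ (fun _ _ => by positivity) ?_) _
        rw [Finset.sum_const, nsmul_eq_mul]
        exact mul_one_div_cancel hc'.ne'
    _ ≤ (∏ b ∈ N, rightFactor H E α β b) * (L * R) := by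
        refine mul_le_mul_left (Finset.prod_le_prod' fun b hb => ?_) _
        have hb' : E w b := by simpa [hN] using hb
        refine (NNReal.rpow_le_rpow (sum_mul_rightFactor_pow_le H hs E α β hw hb')
          (by positivity)).trans (le_of_eq ?_)
        rw [← NNReal.rpow_natCast, ← NNReal.rpow_mul, mul_one_div_cancel hc'.ne', NNReal.rpow_one]
    _ = _ := by
        rw [← Finset.prod_filter_mul_prod_filter_not Finset.univ (fun b => E w b)]
        ring

end Bipartite

/-! ### The bipartite double cover -/

section DoubleCover

open scoped Classical in
theorem prod_adj_eq_prod_edgeFinset {N V : Type*} [CommMonoid N] [Fintype V] (G : SimpleGraph V)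
    (f : V → V → N) (g : Sym2 V → N) (h : ∀ a b, G.Adj a b → g s(a, b) = f a b * f b a) :
    ∏ b, ∏ a with G.Adj a b, f a b = ∏ e ∈ G.edgeFinset, g e := by
  simp_rw [Finset.prod_filter]
  rw [← Finset.prod_product' Finset.univ Finset.univ (fun b a => if G.Adj a b then f a b else 1),
    ← Finset.prod_filter (fun p : V × V => G.Adj p.2 p.1) (fun p => f p.2 p.1)]
  rw [← Finset.prod_fiberwise_of_maps_to (t := G.edgeFinset) (g := fun p : V × V => s(p.2, p.1))
    (fun p hp => by simpa using hp)]
  refine Finset.prod_congr rfl fun e he => ?_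
  induction e with | _ a b =>
  have hab : G.Adj a b := by simpa using he
  rw [h a b hab]
  have : (Finset.filter (fun p : V × V => s(p.2, p.1) = s(a, b))
      (Finset.filter (fun p : V × V => G.Adj p.2 p.1) (Finset.univ ×ˢ Finset.univ))) =
      {(b, a), (a, b)} := by
    ext ⟨u, v⟩
    simp only [Finset.mem_filter, Finset.mem_product, Finset.mem_univ, true_and, Sym2.eq_iff,
      Finset.mem_insert, Finset.mem_singleton, Prod.mk.injEq]
    constructor
    · rintro ⟨-, h | h⟩
      · exact Or.inl ⟨h.2, h.1⟩
      · exact Or.inr ⟨h.2, h.1⟩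
    · rintro (⟨rfl, rfl⟩ | ⟨rfl, rfl⟩)
      · exact ⟨hab, Or.inl ⟨rfl, rfl⟩⟩
      · exact ⟨hab.symm, Or.inr ⟨rfl, rfl⟩⟩
  rw [this, Finset.prod_pair]
  intro h
  exact hab.ne' (Prod.mk.inj h).1

/-- If all exponents are even, every term is nonnegative. Otherwise swapping the pair at a vertex
with odd exponent changes the sign of every term, so the sum vanishes. -/
theorem sum_mul_prod_pow_nonneg {S V : Type*} [Fintype S] [Fintype V] [DecidableEq V]
    (W : (V → S × S) → ℝ) (hW : ∀ z, 0 ≤ W z)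
    (hWs : ∀ z v, W (Function.update z v (z v).swap) = W z) (τ : S × S → ℝ)
    (hτ : ∀ a, τ a.swap = -τ a) (k : V → ℕ) :
    0 ≤ ∑ z, W z * ∏ v, τ (z v) ^ k v := by
  by_cases hk : ∀ v, Even (k v)
  · exact Finset.sum_nonneg fun z _ =>
      mul_nonneg (hW z) (Finset.prod_nonneg fun v _ => (hk v).pow_nonneg _)
  · push Not at hk
    obtain ⟨v, hv⟩ := hk
    rw [Nat.not_even_iff_odd] at hv
    have hinv : Function.Involutive fun z : V → S × S => Function.update z v (z v).swap := by
      intro z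
      simp
    have h := Equiv.sum_comp (Function.Involutive.toPerm _ hinv) fun z => W z * ∏ v, τ (z v) ^ k v
    have h2 : ∀ z : V → S × S, ∏ u, τ (Function.update z v (z v).swap u) ^ k u =
        - ∏ u, τ (z u) ^ k u := by
      intro z
      rw [← Finset.mul_prod_erase _ _ (Finset.mem_univ v),
        ← Finset.mul_prod_erase Finset.univ (fun u => τ (z u) ^ k u) (Finset.mem_univ v),
        Function.update_self, hτ, hv.neg_pow, neg_mul]
      congr 2
      refine Finset.prod_congr rfl fun u hu => ?_
      rw [Function.update_of_ne (Finset.mem_erase.1 hu).1]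
    simp only [Function.Involutive.coe_toPerm, hWs, h2, mul_neg, Finset.sum_neg_distrib] at h
    linarith

theorem prod_sym2_eq_prod_pow {V : Type*} [Fintype V] [DecidableEq V] (t : Finset (Sym2 V))
    (ht : ∀ e ∈ t, ¬ e.IsDiag) (σ : V → ℝ) :
    ∏ e ∈ t, Sym2.lift ⟨fun u v => σ u * σ v, fun _ _ => mul_comm _ _⟩ e =
      ∏ v, σ v ^ (t.filter (v ∈ ·)).card := by
  simp_rw [← Finset.prod_const, Finset.prod_filter]
  rw [Finset.prod_comm]
  refine Finset.prod_congr rfl fun e he => ?_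
  have hd := ht e he
  induction e with | _ a b =>
  have hab : a ≠ b := by simpa using hd
  rw [← Finset.prod_filter]
  have : Finset.univ.filter (fun v => v ∈ s(a, b)) = {a, b} := by
    ext v; simp
  rw [this, Finset.prod_pair hab]
  rfl

/-- The edge factor of the disjoint union of two copies of a graph. -/
def straightFactor (M : SpinModel (Fin 2)) (a b : Fin 2 × Fin 2) : ℝ := M.H a.1 b.1 * M.H a.2 b.2

/-- The edge factor of the bipartite double cover of a graph. -/
def crossFactor (M : SpinModel (Fin 2)) (a b : Fin 2 × Fin 2) : ℝ := M.H a.1 b.2 * M.H b.1 a.2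

/-- With two spins the difference of the two edge factors is, up to sign or vanishing, the
determinant of `H`; the signs factor over the endpoints. -/
theorem crossFactor_sub (M : SpinModel (Fin 2)) (a b : Fin 2 × Fin 2) :
    M.crossFactor a b - M.straightFactor a b =
      (M.H 0 1 ^ 2 - M.H 0 0 * M.H 1 1) *
        ((((a.1 : ℕ) : ℝ) - (a.2 : ℕ)) * (((b.1 : ℕ) : ℝ) - (b.2 : ℕ))) := by
  have h := M.H_symm 1 0
  obtain ⟨a1, a2⟩ := a
  obtain ⟨b1, b2⟩ := b
  fin_cases a1 <;> fin_cases a2 <;> fin_cases b1 <;> fin_cases b2 <;>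
    simp [crossFactor, straightFactor, h] <;> ring

theorem straightFactor_comm (M : SpinModel (Fin 2)) (a b : Fin 2 × Fin 2) :
    M.straightFactor a b = M.straightFactor b a := by
  simp only [straightFactor, M.H_symm a.1, M.H_symm a.2]

theorem crossFactor_comm (M : SpinModel (Fin 2)) (a b : Fin 2 × Fin 2) :
    M.crossFactor a b = M.crossFactor b a := mul_comm _ _

theorem crossFactor_add_swap (M : SpinModel (Fin 2)) (a b : Fin 2 × Fin 2) :
    M.crossFactor a.swap b + M.straightFactor a.swap b =
      M.crossFactor a b + M.straightFactor a b := by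
  simp only [crossFactor, straightFactor, Prod.fst_swap, Prod.snd_swap]
  rw [M.H_symm b.1 a.1, M.H_symm b.1 a.2]
  ring

/-- The evaluation of a symmetric function of two spins at an unordered pair of vertices. -/
def onEdge {S V : Type*} (f : S → S → ℝ) (hf : ∀ a b, f a b = f b a) (z : V → S) (e : Sym2 V) : ℝ :=
  Sym2.lift ⟨fun u v => f (z u) (z v), fun _ _ => hf _ _⟩ e

-- Write the cross and straight factors as `p + D τ τ` and `p - D τ τ`, with `p` invariant under
-- swaps and `D ≥ 0`. Expanding over edge subsets `F`, each cross term is nonnegative by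
-- `sum_mul_prod_pow_nonneg`, and the straight term differs by `(-1) ^ |F|`.
open scoped Classical in
theorem sum_straight_le_sum_cross (M : SpinModel (Fin 2)) (hM : M.H 0 0 * M.H 1 1 ≤ M.H 0 1 ^ 2)
    {V : Type*} [Fintype V] (G : SimpleGraph V) :
    ∑ z : V → Fin 2 × Fin 2, (∏ v, M.weight (z v).1 * M.weight (z v).2) *
        ∏ e ∈ G.edgeFinset, onEdge M.straightFactor M.straightFactor_comm z e ≤
      ∑ z : V → Fin 2 × Fin 2, (∏ v, M.weight (z v).1 * M.weight (z v).2) *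
        ∏ e ∈ G.edgeFinset, onEdge M.crossFactor M.crossFactor_comm z e := by
  set Λ : (V → Fin 2 × Fin 2) → ℝ := fun z => ∏ v, M.weight (z v).1 * M.weight (z v).2 with hΛ
  set τ : Fin 2 × Fin 2 → ℝ := fun a => ((a.1 : ℕ) : ℝ) - (a.2 : ℕ) with hτ
  set D : ℝ := (M.H 0 1 ^ 2 - M.H 0 0 * M.H 1 1) / 2 with hD
  have hD0 : 0 ≤ D := by rw [hD]; linarith
  let pf : Fin 2 × Fin 2 → Fin 2 × Fin 2 → ℝ := fun a b =>
    (M.crossFactor a b + M.straightFactor a b) / 2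
  have hpf : ∀ a b, pf a b = pf b a := fun a b => by
    simp only [pf, M.crossFactor_comm a, M.straightFactor_comm a]
  have hpf0 : ∀ a b, 0 ≤ pf a b := fun a b => by
    have := M.H_nonneg
    have h1 : 0 ≤ M.crossFactor a b := mul_nonneg (this _ _) (this _ _)
    have h2 : 0 ≤ M.straightFactor a b := mul_nonneg (this _ _) (this _ _)
    simp only [pf]; linarith
  have hpfs : ∀ a b, pf a.swap b = pf a b := fun a b => by
    simp only [pf, M.crossFactor_add_swap]
  have hpfs' : ∀ a b, pf a b.swap = pf a b := fun a b => by
    rw [hpf, hpfs, hpf]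
  let t : (V → Fin 2 × Fin 2) → Sym2 V → ℝ := fun z e =>
    Sym2.lift ⟨fun u v => τ (z u) * τ (z v), fun _ _ => mul_comm _ _⟩ e
  have hc : ∀ z e, onEdge M.crossFactor M.crossFactor_comm z e = D * t z e + onEdge pf hpf z e := by
    intro z e
    induction e with | _ u v =>
    have := M.crossFactor_sub (z u) (z v)
    change M.crossFactor (z u) (z v) = D * (τ (z u) * τ (z v)) + pf (z u) (z v)
    simp only [hD, hτ, pf]
    linarith
  have hst : ∀ z e, onEdge M.straightFactor M.straightFactor_comm z e =
      (-1) * (D * t z e) + onEdge pf hpf z e := by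
    intro z e
    induction e with | _ u v =>
    have := M.crossFactor_sub (z u) (z v)
    change M.straightFactor (z u) (z v) = (-1) * (D * (τ (z u) * τ (z v))) + pf (z u) (z v)
    simp only [hD, hτ, pf]
    linarith
  have key : ∀ F ∈ G.edgeFinset.powerset, 0 ≤ ∑ z, Λ z *
      ((∏ e ∈ F, D * t z e) * ∏ e ∈ G.edgeFinset \ F, onEdge pf hpf z e) := by
    intro F hF
    have hF' : ∀ e ∈ F, ¬ e.IsDiag := fun e he =>
      G.not_isDiag_of_mem_edgeFinset (Finset.mem_powerset.1 hF he)
    have h := sum_mul_prod_pow_nonneg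
      (fun z => Λ z * (D ^ F.card * ∏ e ∈ G.edgeFinset \ F, onEdge pf hpf z e)) ?_ ?_ τ ?_
      (fun v => (F.filter (v ∈ ·)).card)
    · refine h.trans (le_of_eq (Finset.sum_congr rfl fun z _ => ?_))
      rw [Finset.prod_mul_distrib, Finset.prod_const,
        ← prod_sym2_eq_prod_pow F hF' (fun v => τ (z v))]
      ring
    · intro z
      refine mul_nonneg (Finset.prod_nonneg fun v _ =>
        mul_nonneg (M.weight_nonneg _) (M.weight_nonneg _)) (mul_nonneg (pow_nonneg hD0 _)
          (Finset.prod_nonneg fun e _ => ?_))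
      induction e with | _ u v => exact hpf0 _ _
    · intro z v
      have hu : ∀ u, Function.update z v (z v).swap u = z u ∨
          Function.update z v (z v).swap u = (z u).swap := by
        intro u
        rcases eq_or_ne u v with rfl | h
        · right; simp
        · left; rw [Function.update_of_ne h]
      congr 1
      · refine Finset.prod_congr rfl fun u _ => ?_
        rcases hu u with h | h
        · rw [h]
        · rw [h, Prod.fst_swap, Prod.snd_swap, mul_comm]
      · congr 1
        refine Finset.prod_congr rfl fun e _ => ?_
        induction e with | _ a b =>
        change pf _ _ = pf _ _
        rcases hu a with h | h <;> rcases hu b with h' | h' <;> rw [h, h'] <;>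
          simp only [hpfs, hpfs']
    · intro a
      simp [hτ]
  simp_rw [hc, hst, Finset.prod_add, Finset.mul_sum]
  rw [Finset.sum_comm, Finset.sum_comm (s := Finset.univ) (t := G.edgeFinset.powerset)]
  refine Finset.sum_le_sum fun F hF => ?_
  have hk := key F hF
  have : ∑ z, Λ z * ((∏ e ∈ F, (-1) * (D * t z e)) *
      ∏ e ∈ G.edgeFinset \ F, onEdge pf hpf z e) = (-1) ^ F.card * ∑ z, Λ z *
      ((∏ e ∈ F, D * t z e) * ∏ e ∈ G.edgeFinset \ F, onEdge pf hpf z e) := by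
    rw [Finset.mul_sum]
    refine Finset.sum_congr rfl fun z _ => ?_
    rw [Finset.prod_mul_distrib, Finset.prod_const]
    ring
  rw [this]
  rcases neg_one_pow_eq_or ℝ F.card with h | h <;> rw [h] <;> linarith

end DoubleCover

/-! ### The antiferromagnetic bound via the double cover. -/

section Antiferromagnetic

open scoped Classical in
theorem coe_bicliqueSum {Ω : Type w} [Fintype Ω] (M : SpinModel Ω) (a b : ℕ) :
    (bicliqueSum M.nnEdge a b M.nnWeight M.nnWeight : ℝ) = M.homBiclique a b := by
  rw [bicliqueSum_eq_sum, homBiclique]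
  push_cast
  unfold hom
  refine (Fintype.sum_prod_type' fun (x : Fin a → Ω) (y : Fin b → Ω) =>
    (∏ i, (M.nnWeight (x i) : ℝ)) * (∏ j, (M.nnWeight (y j) : ℝ)) *
      ∏ j, ∏ i, (M.nnEdge (x i) (y j) : ℝ)).symm.trans ?_
  refine Finset.sum_equiv (Equiv.sumArrowEquivProdArrow (Fin a) (Fin b) Ω).symm (by simp) ?_
  rintro ⟨x, y⟩ -
  rw [mul_comm, Fintype.prod_sum_type]
  congr 1
  rw [Finset.prod_comm, ← Finset.prod_product' Finset.univ Finset.univ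
    (fun i j => ((M.nnEdge (x i) (y j) : ℝ≥0) : ℝ))]
  refine Finset.prod_bij (fun p _ => s(Sum.inl p.1, Sum.inr p.2)) ?_ ?_ ?_ ?_
  · intro p _
    simp
  · rintro ⟨i, j⟩ _ ⟨k, l⟩ _ h
    simpa using h
  · intro e he
    induction e with | _ u v =>
    rcases u with u | u <;> rcases v with v | v
    · simp at he
    · exact ⟨(u, v), by simp, rfl⟩
    · exact ⟨(v, u), by simp, Sym2.eq_swap⟩
    · simp at he
  · intro p _; rfl

open scoped Classical in
theorem hom_sq_le (M : SpinModel (Fin 2)) (hM : M.H 0 0 * M.H 1 1 ≤ M.H 0 1 ^ 2)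
    {V : Type*} [Fintype V] (G : SimpleGraph V) :
    M.hom G ^ 2 ≤
      bipartiteSum M.nnEdge G.Adj (fun _ => M.nnWeight) (fun _ => M.nnWeight) := by
  have h := sum_straight_le_sum_cross M hM G
  rw [← (Equiv.arrowProdEquivProdArrow V (fun _ => Fin 2) (fun _ => Fin 2)).symm.sum_comp,
    ← (Equiv.arrowProdEquivProdArrow V (fun _ => Fin 2) (fun _ => Fin 2)).symm.sum_comp,
    Fintype.sum_prod_type, Fintype.sum_prod_type] at h
  refine le_trans (le_of_eq ?_) (h.trans (le_of_eq ?_))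
  · unfold hom
    rw [sq, Finset.sum_mul_sum]
    refine Finset.sum_congr rfl fun x _ => Finset.sum_congr rfl fun y _ => ?_
    have : ∀ e, onEdge M.straightFactor M.straightFactor_comm
        ((Equiv.arrowProdEquivProdArrow V (fun _ => Fin 2) (fun _ => Fin 2)).symm (x, y)) e =
        M.edgeFactor x e * M.edgeFactor y e := by
      intro e
      induction e with | _ u v => rfl
    simp_rw [this]
    rw [Finset.prod_mul_distrib, Finset.prod_mul_distrib]
    simp only [Equiv.arrowProdEquivProdArrow_symm_apply]
    ring
  · unfold bipartiteSum
    push_cast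
    refine Finset.sum_congr rfl fun x _ => Finset.sum_congr rfl fun y _ => ?_
    rw [mul_comm, ← Finset.prod_mul_distrib]
    congr 1
    symm
    refine prod_adj_eq_prod_edgeFinset G (fun a b => ((M.nnEdge (x a) (y b) : ℝ≥0) : ℝ)) _ ?_
    intro a b _
    rfl

open scoped Classical in
theorem isBicliqueMaximizing_of_le (M : SpinModel (Fin 2))
    (hM : M.H 0 0 * M.H 1 1 ≤ M.H 0 1 ^ 2) : IsBicliqueMaximizing.{u} M := by
  intro V _ G hG
  have hd : ∀ v, rightDegree G.Adj v = G.degree v := by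
    intro v
    unfold rightDegree
    rw [← SimpleGraph.card_neighborFinset_eq_degree]
    congr 1
    ext; simp
  have hl : ∀ v, leftNeighbors G.Adj v = G.neighborFinset v := by
    intro v
    ext u
    simp [mem_leftNeighbors, G.adj_comm]
  have hd0 : ∀ v, G.degree v ≠ 0 := by
    intro v h
    exact hG v ((G.degree_eq_zero v).1 h)
  have h1 := hom_sq_le M hM G
  have h2 := NNReal.coe_le_coe.2 (bipartiteSum_le M.nnEdge M.nnEdge_symm G.Adj
    (fun _ => M.nnWeight) (fun _ => M.nnWeight))
  have hb0 : ∀ e, 0 ≤ M.bicliqueFactor G e := by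
    intro e
    induction e with | _ u v =>
    change 0 ≤ M.homBiclique _ _ ^ (_ : ℝ)
    rw [← coe_bicliqueSum]
    positivity
  refine le_of_pow_le_pow_left₀ two_ne_zero (Finset.prod_nonneg fun e _ => hb0 e) ?_
  refine h1.trans (h2.trans (le_of_eq ?_))
  rw [← Finset.prod_pow]
  simp only [hd, hd0, if_false, Finset.prod_const_one, one_mul]
  -- The square of an edge factor is split over the two orientations of the edge, matching the two
  -- lifts in the double cover.
  rw [← prod_adj_eq_prod_edgeFinset G (fun a b => M.bicliqueFactor G s(a, b))]
  · push_cast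
    refine Finset.prod_congr rfl fun b _ => ?_
    unfold rightFactor
    simp only [hl, SimpleGraph.card_neighborFinset_eq_degree, hd0, if_false, one_mul, hd]
    push_cast
    refine Finset.prod_congr ?_ fun a _ => ?_
    · ext a; simp [G.adj_comm]
    · rw [coe_bicliqueSum, Sym2.eq_swap]
      rfl
  · intro a b _
    rw [sq, Sym2.eq_swap (a := b)]

end Antiferromagnetic

/-! ### Spectral characterizations -/

section Spectrum

theorem eigenvalues_fin_two {A : Matrix (Fin 2) (Fin 2) ℝ} (hA : A.IsHermitian)
    [inst : DecidableEq (Fin 2)] :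
    hA.eigenvalues 0 + hA.eigenvalues 1 = A 0 0 + A 1 1 ∧
      hA.eigenvalues 0 * hA.eigenvalues 1 = A 0 0 * A 1 1 - A 0 1 ^ 2 := by
  obtain rfl : inst = instDecidableEqFin 2 := Subsingleton.elim _ _
  have h1 := hA.trace_eq_sum_eigenvalues
  have h2 := hA.det_eq_prod_eigenvalues
  have h3 : A 1 0 = A 0 1 := by simpa using hA.apply 0 1
  simp [Matrix.trace, Fin.sum_univ_two] at h1
  simp [Matrix.det_fin_two, Fin.prod_univ_two, h3] at h2
  exact ⟨h1.symm, by rw [← h2]; ring⟩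

theorem eigenvalues₀_fin_two {A : Matrix (Fin 2) (Fin 2) ℝ} (hA : A.IsHermitian)
    [inst : DecidableEq (Fin 2)] :
    hA.eigenvalues₀ (0 : Fin 2) + hA.eigenvalues₀ (1 : Fin 2) = A 0 0 + A 1 1 ∧
      hA.eigenvalues₀ (0 : Fin 2) * hA.eigenvalues₀ (1 : Fin 2) = A 0 0 * A 1 1 - A 0 1 ^ 2 := by
  obtain ⟨h1, h2⟩ := eigenvalues_fin_two hA
  -- This is the reindexing between `eigenvalues` and `eigenvalues₀`; sum and product do not depend
  -- on it.
  let e : Fin 2 ≃ Fin 2 := (Fintype.equivOfCardEq (Fintype.card_fin (Fintype.card (Fin 2)))).symm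
  have h : ∀ f : Fin 2 → ℝ, f (e 0) + f (e 1) = f 0 + f 1 ∧ f (e 0) * f (e 1) = f 0 * f 1 := by
    intro f
    have hs := e.sum_comp f
    have hp := e.prod_comp f
    rw [Fin.sum_univ_two, Fin.sum_univ_two] at hs
    rw [Fin.prod_univ_two, Fin.prod_univ_two] at hp
    exact ⟨hs, hp⟩
  exact ⟨(h hA.eigenvalues₀).1.symm.trans h1, (h hA.eigenvalues₀).2.symm.trans h2⟩

theorem isAntiferromagnetic_iff (M : SpinModel (Fin 2)) :
    M.IsAntiferromagnetic ↔ M.H 0 0 * M.H 1 1 ≤ M.H 0 1 ^ 2 := by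
  classical
  unfold IsAntiferromagnetic
  obtain ⟨h1, h2⟩ := eigenvalues₀_fin_two M.isHermitian_H
    (inst := fun a b => Classical.propDecidable (a = b))
  have h3 := M.isHermitian_H.eigenvalues₀_antitone (Fin.zero_le (1 : Fin 2))
  have h00 := M.H_nonneg 0 0
  have h11 := M.H_nonneg 1 1
  constructor
  · intro h
    -- The trace is nonnegative, so a nonpositive second eigenvalue forces a nonnegative first one,
    -- hence a nonpositive determinant.
    have h4 := h (1 : Fin 2) Nat.one_pos
    nlinarith
  · intro h i hi
    have hi1 : i = (1 : Fin 2) := by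
      have h5 : (i : ℕ) < 2 := i.2
      exact Fin.ext (show (i : ℕ) = 1 by omega)
    subst hi1
    by_contra hc
    push Not at hc
    exact absurd (mul_pos (hc.trans_le h3) hc)
      (not_lt.2 ((le_of_eq h2).trans (sub_nonpos.2 h)))

theorem isFerromagnetic_iff (M : SpinModel (Fin 2)) :
    M.IsFerromagnetic ↔ M.H 0 1 ^ 2 ≤ M.H 0 0 * M.H 1 1 := by
  have h10 : M.H 1 0 = M.H 0 1 := M.H_symm 1 0
  constructor
  · intro h
    have := h.det_nonneg
    rw [Matrix.det_fin_two, h10] at this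
    linarith
  · intro h
    refine Matrix.PosSemidef.of_dotProduct_mulVec_nonneg M.isHermitian_H fun x => ?_
    have h00 := M.H_nonneg 0 0
    have h11 := M.H_nonneg 1 1
    have h01 := M.H_nonneg 0 1
    have hq : star x ⬝ᵥ M.H.mulVec x =
        M.H 0 0 * x 0 ^ 2 + 2 * M.H 0 1 * (x 0 * x 1) + M.H 1 1 * x 1 ^ 2 := by
      simp [dotProduct, Matrix.mulVec, Fin.sum_univ_two, h10]
      ring
    rw [hq]
    -- The quadratic form is then at least the square in `h8`; the absolute values cover a negative
    -- cross term.
    have h5 : M.H 0 1 ≤ Real.sqrt (M.H 0 0) * Real.sqrt (M.H 1 1) := by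
      rw [← Real.sqrt_mul h00]
      exact Real.le_sqrt_of_sq_le h
    have h6 := Real.sq_sqrt h00
    have h7 := Real.sq_sqrt h11
    have h8 := sq_nonneg (Real.sqrt (M.H 0 0) * |x 0| - Real.sqrt (M.H 1 1) * |x 1|)
    have h9 : -(|x 0| * |x 1|) ≤ x 0 * x 1 := by
      rw [← abs_mul]; exact neg_abs_le _
    have h12 := mul_le_mul_of_nonneg_right h5 (by positivity : 0 ≤ |x 0| * |x 1|)
    have h13 := mul_le_mul_of_nonneg_left h9 h01
    have h14 : (Real.sqrt (M.H 0 0) * |x 0| - Real.sqrt (M.H 1 1) * |x 1|) ^ 2 =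
        Real.sqrt (M.H 0 0) ^ 2 * |x 0| ^ 2 + Real.sqrt (M.H 1 1) ^ 2 * |x 1| ^ 2 -
          2 * (Real.sqrt (M.H 0 0) * Real.sqrt (M.H 1 1) * (|x 0| * |x 1|)) := by ring
    rw [h6, h7, sq_abs, sq_abs] at h14
    linarith

end Spectrum

end SpinModel

theorem mainTheorem8 (M : SpinModel (Fin 2)) :
    (M.IsAntiferromagnetic ↔ M.H 0 0 * M.H 1 1 ≤ M.H 0 1 ^ 2) ∧
    (M.IsFerromagnetic ↔ M.H 0 1 ^ 2 ≤ M.H 0 0 * M.H 1 1) ∧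
    (M.IsAntiferromagnetic → SpinModel.IsBicliqueMaximizing.{u, 0} M) ∧
    (M.IsFerromagnetic → SpinModel.IsCliqueMaximizing.{u, 0} M) :=
  ⟨M.isAntiferromagnetic_iff, M.isFerromagnetic_iff,
    fun h => M.isBicliqueMaximizing_of_le (M.isAntiferromagnetic_iff.1 h),
    fun h => SpinModel.IsFerromagnetic.isCliqueMaximizing M h⟩
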